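/- Let $E\to M$ be a Courant algebroid over a smooth manifold $M$: a smooth vector bundle of constant rank with a fibrewise nondegenerate symmetric bilinear form $\langle\cdot,\cdot\rangle$, a bundle map $\rho:E\to TM$ and an $\mathbb R$-bilinear bracket $[\![\cdot,\cdot]\!]$ on $\Gamma(E)$ such that, for all $e_1,e_2,e_3\in\Gamma(E)$, $$[\![e_1,[\![e_2,e_3]\!]]\!]=[\![[\![e_1,e_2]\!],e_3]\!]+[\![e_2,[\![e_1,e_3]\!]]\!],$$ $$\rho(e_1)\langle e_2,e_3\rangle=\langle[\![e_1,e_2]\!],e_3\rangle+\langle e_2,[\![e_1,e_3]\!]\rangle,\qquad [\![e_1,e_2]\!]+[\![e_2,e_1]\!]=d_E\langle e_1,e_2\rangle .$$ Here $\rho^*:\Omega^1(M)\to\Gamma(E)$ is defined by $\langle\rho^*\alpha,e\rangle=\alpha(\rho(e))$, and $d_Ef=\rho^*(df)$. Let $B\to M$ be a predual of $E$: a smooth vector bundle of constant rank with a smooth fibrewise bilinear pairing $\langle\!\langle\cdot,\cdot\rangle\!\rangle:E\times_M B\to\mathbb R$ and a map $d_B:C^\infty(M)\to\Gamma(B)$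 with $\langle\!\langle e,d_Bf\rangle\!\rangle=\rho(e)(f)$. Let $\nabla$ be an $E$-Dorfman connection on $B$: an $\mathbb R$-bilinear map $\Gamma(E)\times\Gamma(B)\to\Gamma(B)$ with $$\nabla_{fe}b=f\nabla_eb+\langle\!\langle e,b\rangle\!\rangle d_Bf,\qquad \nabla_e(fb)=f\nabla_eb+\rho(e)(f)\,b,\qquad \nabla_e(d_Bf)=d_B(\rho(e)(f)).$$ For a $C^\infty(M)$-module $W$ (here $W=\Gamma(\mathrm{End}(B))$) and $m\ge 1$, let $\mathfrak D^p_{m,m-1}(E;W)$ be the space of tuples $\Phi=(\Phi_0,\dots,\Phi_{[p/2]})$ of $\mathbb R$-multilinear maps $\Phi_k(e_1,\dots,e_{p-2k};\alpha_1,\dots,\alpha_k)\in W$, with $e_i\in\Gamma(E)$ and $\alpha_\mu\in\Omega^1(M)$, which are symmetric in the $\alpha_\mu$, satisfy $$\Phi_k(\dots,e,e',\dots;\dots)+\Phi_k(\dots,e',e,\dots;\dots)=-\Phi_{k+1}(\dots,\hat e,\hat e',\dots;d\langle e,e'\rangle,\dots),$$ and are differential operators of order at most $m$ in each one-form and in each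 section, and of order at most $m-1$ in the last section (for $p\neq1$). Order $0$ means $C^\infty(M)$-linear, and an operator $D$ has order at most $s+1$ in an argument if each $v\mapsto D(fv)-fD(v)$ has order at most $s$. One also writes $\Phi_k(\dots;f_1,\dots,f_k)=\Phi_k(\dots;df_1,\dots,df_k)$. The covariant derivative of a $\Gamma(B)$-valued $p$-cochain $H$ is $$\begin{aligned}(d^\nabla H)_k(e_1,\dots,e_{p+1-2k};f_1,\dots,f_k)={}&\sum_{\mu}H_{k-1}(d_Ef_\mu,e_1,\dots,e_{p+1-2k};\dots,\hat f_\mu,\dots)\\&+\sum_i(-1)^{i-1}\nabla_{e_i}\big(H_k(\dots,\hat e_i,\dots;f_1,\dots,f_k)\big)\\&+\sum_{i<j}(-1)^iH_k(\dots,\hat e_i,\dots,\hat e_j,[\![e_i,e_j]\!],e_{j+1},\dots;f_1,\dots,f_k),\end{aligned}$$ and sections of $B$ are the $0$-cochains. On cochains let $(i_eH)_k(\dots;\dots)=H_k(e,\dots;\dots)$ and $(i_fH)_k(\dots;\dots)=H_{k+1}(\dots;f,\dots)$. Then the curvature $b\mapsto(d^\nabla)^2b$ is $C^\infty(M)$-linear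 in $b\in\Gamma(B)$ and is given by an element $R=(R_0,R_1)$ of $\mathfrak D^2_{2,1}(E;\Gamma(\mathrm{End}(B)))$, with $R_1(\alpha)b=\nabla_{\rho^*\alpha}b$ for $\alpha\in\Omega^1(M)$. For all $e_1,e_2\in\Gamma(E)$, $f\in C^\infty(M)$ and $b\in\Gamma(B)$, $$R_0(e_1,e_2)b=i_{e_2}i_{e_1}\big((d^\nabla)^2b\big)=\nabla_{e_1}\nabla_{e_2}b-\nabla_{e_2}\nabla_{e_1}b-\nabla_{[\![e_1,e_2]\!]}b,\qquad R_1(f)b=i_f\big((d^\nabla)^2b\big)=\nabla_{d_Ef}b .$$ Moreover the curvature vanishes on $\mathrm{Im}\,d_B$: for all $g\in C^\infty(M)$, $(d^\nabla)^2(d_Bg)=0$, and all values $R_0(e_1,e_2)$, $R_1(\alpha)$ annihilate $d_Bg$. -/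

import Mathlib

open Bundle
open scoped Manifold ContDiff Bundle

noncomputable section

namespace Dorfman

section Basic

variable {n : ℕ} {M : Type*} [TopologicalSpace M] [ChartedSpace (EuclideanSpace ℝ (Fin n)) M]

/-- The ring `C^∞(M)`. -/
abbrev Fun (n : ℕ) (M : Type*) [TopologicalSpace M]
    [ChartedSpace (EuclideanSpace ℝ (Fin n)) M] : Type _ :=
  C^∞⟮𝓡 n, M; 𝓘(ℝ, ℝ), ℝ⟯

/-- The space `Γ(V)` of smooth sections of a vector bundle `V → M` with typical fibre `F`. -/
abbrev Sec (n : ℕ) {M : Type*} [TopologicalSpace M]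
    [ChartedSpace (EuclideanSpace ℝ (Fin n)) M] (F : Type*) [NormedAddCommGroup F]
    [NormedSpace ℝ F] (V : M → Type*) [TopologicalSpace (TotalSpace F V)]
    [∀ x, TopologicalSpace (V x)] [FiberBundle F V] : Type _ :=
  Cₛ^∞⟮𝓡 n; F, V⟯

variable {F : Type*} [NormedAddCommGroup F] [NormedSpace ℝ F]
  {V : M → Type*} [TopologicalSpace (TotalSpace F V)] [∀ x, AddCommGroup (V x)]
  [∀ x, Module ℝ (V x)] [∀ x, TopologicalSpace (V x)] [FiberBundle F V] [VectorBundle ℝ F V]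

/-- Pointwise multiplication of sections by smooth functions. -/
instance instSMulSec : SMul (Fun n M) (Sec n F V) where
  smul f s := ⟨fun x => f x • s x, ContMDiff.smul_section f.contMDiff s.contMDiff⟩

theorem smul_sec_apply (f : Fun n M) (s : Sec n F V) (x : M) : (f • s) x = f x • s x := rfl

instance instModuleSec : Module (Fun n M) (Sec n F V) where
  one_smul s := by ext x; exact one_smul ℝ (s x)
  mul_smul f g s := by ext x; exact mul_smul (f x) (g x) (s x)
  smul_zero f := by ext x; exact smul_zero (f x)
  smul_add f s t := by ext x; exact smul_add (f x) (s x) (t x)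
  add_smul f g s := by ext x; exact add_smul (f x) (g x) (s x)
  zero_smul s := by ext x; exact zero_smul ℝ (s x)

variable (n M) in
/-- The space `Ω¹(M)` of smooth sections of `T*M = Hom(TM, ℝ)`. -/
abbrev OneForm [IsManifold (𝓡 n) ∞ M] : Type _ :=
  Sec n (EuclideanSpace ℝ (Fin n) →L[ℝ] ℝ)
    (fun x : M => TangentSpace (𝓡 n) x →L[ℝ] Bundle.Trivial M ℝ x)

/-- The de Rham differential `df` of a smooth function. -/
def extd [IsManifold (𝓡 n) ∞ M] (f : Fun n M) : OneForm n M where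
  toFun x := mfderiv (𝓡 n) 𝓘(ℝ, ℝ) f x
  contMDiff_toFun := by
    intro x₀
    have h := (f.contMDiff x₀).mfderiv_const (m := ∞) (by simp)
    rw [contMDiffAt_hom_bundle]
    refine ⟨contMDiffAt_id, ?_⟩
    convert h using 1
    ext x v
    simp [inTangentCoordinates, ContinuousLinearMap.inCoordinates]
    rfl


/-- The value `⟨s, t⟩ ∈ C^∞(M)` of a smooth field of bilinear pairings `V ×_M V' → ℝ`
on two smooth sections. -/
def pair {F' : Type*} [NormedAddCommGroup F'] [NormedSpace ℝ F']
    {V' : M → Type*} [TopologicalSpace (TotalSpace F' V')] [∀ x, AddCommGroup (V' x)]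
    [∀ x, Module ℝ (V' x)] [∀ x, TopologicalSpace (V' x)] [FiberBundle F' V']
    [VectorBundle ℝ F' V']
    (g : Sec n (F →L[ℝ] F' →L[ℝ] ℝ) (fun x : M => V x →L[ℝ] V' x →L[ℝ] Bundle.Trivial M ℝ x))
    (s : Sec n F V) (t : Sec n F' V') : Fun n M :=
  ⟨fun x => g x (s x) (t x), by
    have h := ContMDiff.clm_bundle_apply₂ (E₃ := Bundle.Trivial M ℝ) (b := fun x : M => x)
      g.contMDiff s.contMDiff t.contMDiff
    intro x
    exact ((contMDiffAt_section (F := ℝ) (E := Bundle.Trivial M ℝ) _).1 (h x))⟩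

/-- The action `X(f) = df(X)` of a vector field of the form `X = ρ(s)` on a smooth function,
where `ρ : V → TM` is a smooth vector bundle map and `s` a section of `V`. -/
def act [IsManifold (𝓡 n) ∞ M]
    (ρ : Sec n (F →L[ℝ] EuclideanSpace ℝ (Fin n)) (fun x : M => V x →L[ℝ] TangentSpace (𝓡 n) x))
    (s : Sec n F V) (f : Fun n M) : Fun n M :=
  ⟨fun x => extd f x (ρ x (s x)), by
    have h := ContMDiff.clm_bundle_apply (E₂ := Bundle.Trivial M ℝ) (b := fun x : M => x)
      (extd f).contMDiff (ContMDiff.clm_bundle_apply (b := fun x : M => x)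
        ρ.contMDiff s.contMDiff)
    intro x
    exact ((contMDiffAt_section (F := ℝ) (E := Bundle.Trivial M ℝ) _).1 (h x))⟩

theorem contMDiffAt_det {ι : Type*} [Fintype ι] [DecidableEq ι] {A : M → Matrix ι ι ℝ} {x : M}
    (h : ∀ i j, ContMDiffAt (𝓡 n) 𝓘(ℝ, ℝ) ∞ (fun y => A y i j) x) :
    ContMDiffAt (𝓡 n) 𝓘(ℝ, ℝ) ∞ (fun y => (A y).det) x := by
  simp only [Matrix.det_apply']
  refine ContMDiffAt.sum fun σ _ => ContMDiffAt.mul contMDiffAt_const ?_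
  exact ContMDiffAt.prod fun i _ => h _ _

theorem exists_sharp [IsManifold (𝓡 n) ∞ M] [FiniteDimensional ℝ F]
    [∀ x, IsTopologicalAddGroup (V x)] [∀ x, ContinuousSMul ℝ (V x)]
    [ContMDiffVectorBundle ∞ F V (𝓡 n)]
    (g : Sec n (F →L[ℝ] F →L[ℝ] ℝ) (fun x : M => V x →L[ℝ] V x →L[ℝ] Bundle.Trivial M ℝ x))
    (hg : ∀ (x : M) (v : V x), (∀ w, g x v w = 0) → v = 0)
    (ρ : Sec n (F →L[ℝ] EuclideanSpace ℝ (Fin n)) (fun x : M => V x →L[ℝ] TangentSpace (𝓡 n) x))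
    (α : OneForm n M) :
    ∃ s : Sec n F V, ∀ (x : M) (w : V x), g x (s x) w = α x (ρ x w) := by
  have hpt : ∀ x : M, ∃ v : V x, ∀ w : V x, g x v w = α x (ρ x w) := by
    intro x
    have : FiniteDimensional ℝ (V x) := VectorBundle.finiteDimensional ℝ F V x
    let L : V x →ₗ[ℝ] Module.Dual ℝ (V x) :=
      { toFun := fun v => ((g x v : V x →L[ℝ] Bundle.Trivial M ℝ x) : V x →ₗ[ℝ] ℝ)
        map_add' := fun a b => by ext w; simp
        map_smul' := fun c a => by ext w; simp }
    have hL : Function.Injective L := by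
      rw [injective_iff_map_eq_zero]
      intro v hv
      exact hg x v fun w => LinearMap.congr_fun hv w
    have hS : Function.Surjective L :=
      (LinearMap.injective_iff_surjective_of_finrank_eq_finrank
        (Subspace.dual_finrank_eq).symm).1 hL
    obtain ⟨v, hv⟩ := hS
      ((((α x : TangentSpace (𝓡 n) x →L[ℝ] Bundle.Trivial M ℝ x).comp (ρ x)) :
        V x →L[ℝ] Bundle.Trivial M ℝ x) : V x →ₗ[ℝ] ℝ)
    exact ⟨v, fun w => LinearMap.congr_fun hv w⟩
  choose s hs using hpt
  refine ⟨⟨s, fun x₀ => ?_⟩, hs⟩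
  let e := trivializationAt F V x₀
  have hx₀ : x₀ ∈ e.baseSet := FiberBundle.mem_baseSet_trivializationAt' x₀
  let b := Module.finBasis ℝ F
  let ε := e.localFrame b
  let G : M → Matrix _ _ ℝ := fun y => Matrix.of fun i j => g y (ε i y) (ε j y)
  let v : M → _ → ℝ := fun y j => α y (ρ y (ε j y))
  have hε : ∀ i, ContMDiffAt (𝓡 n) ((𝓡 n).prod 𝓘(ℝ, F)) ∞ (fun y => TotalSpace.mk' F y (ε i y)) x₀ :=
    fun i => contMDiffAt_localFrame_of_mem ∞ e b i hx₀
  have hG : ∀ i j, ContMDiffAt (𝓡 n) 𝓘(ℝ, ℝ) ∞ (fun y => G y i j) x₀ := by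
    intro i j
    have h := ContMDiffAt.clm_bundle_apply₂ (E₃ := Bundle.Trivial M ℝ) (b := fun x : M => x)
      (g.contMDiff x₀) (hε i) (hε j)
    exact (contMDiffAt_section (F := ℝ) (E := Bundle.Trivial M ℝ) _).1 h
  have hv : ∀ j, ContMDiffAt (𝓡 n) 𝓘(ℝ, ℝ) ∞ (fun y => v y j) x₀ := by
    intro j
    have h := ContMDiffAt.clm_bundle_apply (E₂ := Bundle.Trivial M ℝ) (b := fun x : M => x)
      (α.contMDiff x₀) (ContMDiffAt.clm_bundle_apply (b := fun x : M => x)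
        (ρ.contMDiff x₀) (hε j))
    exact (contMDiffAt_section (F := ℝ) (E := Bundle.Trivial M ℝ) _).1 h
  have hdet : ∀ y ∈ e.baseSet, (G y).det ≠ 0 := by
    intro y hy hd
    obtain ⟨c, hc, hc0⟩ := Matrix.exists_vecMul_eq_zero_iff.2 hd
    have hfr := e.isLocalFrameOn_localFrame_baseSet (𝓡 n) ∞ b
    have hz : ∑ i, c i • ε i y = 0 := by
      apply hg y
      intro w
      have hw : w ∈ Submodule.span ℝ (Set.range (ε · y)) := hfr.generating hy trivial
      induction hw using Submodule.span_induction with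
      | mem w hw =>
        obtain ⟨j, rfl⟩ := hw
        have := congrFun hc0 j
        simpa [Matrix.vecMul, dotProduct, G] using this
      | zero => simp
      | add a b _ _ ha hb => rw [map_add, ha, hb, add_zero]
      | smul r a _ ha => rw [map_smul, ha, smul_zero]
    exact hc (funext fun i => Fintype.linearIndependent_iff.1 (hfr.linearIndependent hy) c hz i)
  have hcoef : ∀ y ∈ e.baseSet, s y = ∑ i, (((G y).det)⁻¹ * (Matrix.vecMul (v y) (G y).adjugate) i) • ε i y := by
    intro y hy
    rw [← sub_eq_zero]
    apply hg y
    intro w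
    have hfr := e.isLocalFrameOn_localFrame_baseSet (𝓡 n) ∞ b
    have hw : w ∈ Submodule.span ℝ (Set.range (ε · y)) := hfr.generating hy trivial
    induction hw using Submodule.span_induction with
    | mem w hw =>
      obtain ⟨j, rfl⟩ := hw
      have key : Matrix.vecMul (Matrix.vecMul (v y) (G y).adjugate) (G y) = (G y).det • v y := by
        rw [Matrix.vecMul_vecMul, Matrix.adjugate_mul, Matrix.vecMul_smul, Matrix.vecMul_one]
      have kj := congrFun key j
      have h1 : g y (s y) (ε j y) = v y j := hs y _
      have h2 : g y (∑ i, (((G y).det)⁻¹ * (Matrix.vecMul (v y) (G y).adjugate) i) • ε i y) (ε j y)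
          = ((G y).det)⁻¹ * (Matrix.vecMul (Matrix.vecMul (v y) (G y).adjugate) (G y)) j := by
        set c := Matrix.vecMul (v y) (G y).adjugate
        rw [map_sum, sum_apply, Matrix.vecMul, dotProduct, Finset.mul_sum]
        refine Finset.sum_congr rfl fun i _ => ?_
        rw [map_smul, smul_apply]
        exact mul_assoc _ _ _
      rw [map_sub, sub_apply, h1, h2, kj, Pi.smul_apply, smul_eq_mul,
        inv_mul_cancel_left₀ (hdet y hy)]
      exact sub_self (v y j)
    | zero => simp
    | add a b _ _ ha hb => rw [map_add, ha, hb, add_zero]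
    | smul r a _ ha => rw [map_smul, ha, smul_zero]
  have hadj : ∀ i j, ContMDiffAt (𝓡 n) 𝓘(ℝ, ℝ) ∞ (fun y => (G y).adjugate i j) x₀ := by
    intro i j
    simp only [Matrix.adjugate_apply]
    apply contMDiffAt_det
    intro k l
    by_cases hk : k = j
    · simpa [Matrix.updateRow_apply, hk] using contMDiffAt_const
    · simpa [Matrix.updateRow_apply, hk] using hG k l
  have hsm : ContMDiffAt (𝓡 n) ((𝓡 n).prod 𝓘(ℝ, F)) ∞ (fun y => TotalSpace.mk' F y
      (∑ i, (((G y).det)⁻¹ * (Matrix.vecMul (v y) (G y).adjugate) i) • ε i y)) x₀ := by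
    refine ContMDiffAt.sum_section fun i _ => ?_
    refine ContMDiffAt.smul_section (f := fun y => ((G y).det)⁻¹ * _) ?_ (hε i)
    refine ContMDiffAt.mul ?_ ?_
    · exact (contMDiffAt_det hG).inv₀ (hdet x₀ hx₀)
    · simp only [Matrix.vecMul, dotProduct]
      exact ContMDiffAt.sum fun j _ => (hv j).mul (hadj j i)
  refine hsm.congr_of_eventuallyEq ?_
  filter_upwards [e.open_baseSet.mem_nhds hx₀] with y hy
  rw [hcoef y hy]

end Basic

section DifferentialOperators

/-- `D` is a differential operator of order at most `s` between modules over the function ring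
`R`: order `0` means `R`-linear, and order at most `s + 1` means that every symbol
`v ↦ D (f v) - f D v` has order at most `s`. -/
def IsDiffOp (R : Type*) [CommRing R] {V W : Type*} [AddCommGroup V] [Module R V]
    [AddCommGroup W] [Module R W] : ℕ → (V → W) → Prop
  | 0, D => ∀ (f : R) (v : V), D (f • v) = f • D v
  | s + 1, D => ∀ f : R, IsDiffOp R s (fun v => D (f • v) - f • D v)

end DifferentialOperators

section Courant

variable {n : ℕ} {M : Type*} [TopologicalSpace M] [ChartedSpace (EuclideanSpace ℝ (Fin n)) M]
  [IsManifold (𝓡 n) ∞ M]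
  {F : Type*} [NormedAddCommGroup F] [NormedSpace ℝ F] [FiniteDimensional ℝ F]
  {E : M → Type*} [TopologicalSpace (TotalSpace F E)] [∀ x, AddCommGroup (E x)]
  [∀ x, Module ℝ (E x)] [∀ x, TopologicalSpace (E x)] [FiberBundle F E] [VectorBundle ℝ F E]
  [ContMDiffVectorBundle ∞ F E (𝓡 n)]
  [∀ x, IsTopologicalAddGroup (E x)] [∀ x, ContinuousSMul ℝ (E x)]

variable (n F E) in
/-- The data of a Courant algebroid on the vector bundle `E → M`: a fibrewise nondegenerate
symmetric bilinear form, an anchor and a bracket on sections. -/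
structure CourantData where
  /-- the smooth field of bilinear forms `⟨·,·⟩` -/
  metric : Sec n (F →L[ℝ] F →L[ℝ] ℝ) (fun x : M => E x →L[ℝ] E x →L[ℝ] Bundle.Trivial M ℝ x)
  metric_symm : ∀ (x : M) (v w : E x), metric x v w = metric x w v
  metric_nondeg : ∀ (x : M) (v : E x), (∀ w, metric x v w = 0) → v = 0
  /-- the smooth vector bundle map `ρ : E → TM` -/
  anchor : Sec n (F →L[ℝ] EuclideanSpace ℝ (Fin n))
    (fun x : M => E x →L[ℝ] TangentSpace (𝓡 n) x)
  /-- the `ℝ`-bilinear bracket on `Γ(E)` -/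
  bracket : Sec n F E →ₗ[ℝ] Sec n F E →ₗ[ℝ] Sec n F E

namespace CourantData

variable (C : CourantData n F E)

/-- The function `⟨e₁, e₂⟩`. -/
def inner (e₁ e₂ : Sec n F E) : Fun n M := pair C.metric e₁ e₂

/-- The function `ρ(e)(f)`. -/
def rho (e : Sec n F E) (f : Fun n M) : Fun n M := act C.anchor e f

/-- The map `ρ* : Ω¹(M) → Γ(E)`, the dual of `ρ` with `E*` identified with `E` by the bilinear form:
`ρ*(α)` is the unique section with `⟨ρ*(α), w⟩ = α(ρ(w))` for all vectors `w` of `E`. -/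
def rhoStar (α : OneForm n M) : Sec n F E :=
  (exists_sharp C.metric C.metric_nondeg C.anchor α).choose

theorem metric_rhoStar (α : OneForm n M) (x : M) (w : E x) :
    C.metric x (C.rhoStar α x) w = α x (C.anchor x w) :=
  (exists_sharp C.metric C.metric_nondeg C.anchor α).choose_spec x w

/-- The map `d_E = ρ* ∘ d`; thus `⟨d_E f, e⟩ = ρ(e)(f)`. -/
def dE (f : Fun n M) : Sec n F E := C.rhoStar (extd f)

theorem inner_dE (f : Fun n M) (e : Sec n F E) : C.inner (C.dE f) e = C.rho e f := by
  ext x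
  exact C.metric_rhoStar (extd f) x (e x)

end CourantData

variable (n F E) in
/-- A Courant algebroid structure on `E → M`. -/
structure CourantAlgebroid extends CourantData n F E where
  jacobi : ∀ e₁ e₂ e₃ : Sec n F E,
    bracket e₁ (bracket e₂ e₃) = bracket (bracket e₁ e₂) e₃ + bracket e₂ (bracket e₁ e₃)
  compat : ∀ e₁ e₂ e₃ : Sec n F E,
    toCourantData.rho e₁ (toCourantData.inner e₂ e₃) =
      toCourantData.inner (bracket e₁ e₂) e₃ + toCourantData.inner e₂ (bracket e₁ e₃)
  bracket_symm : ∀ e₁ e₂ : Sec n F E,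
    bracket e₁ e₂ + bracket e₂ e₁ = toCourantData.dE (toCourantData.inner e₁ e₂)

/-- Membership in `𝔇^p_{m,m-1}(𝓔; W)`, for a `C^∞(M)`-module `W` of values. A `p`-cochain
`Φ = (Φ_0, Φ_1, …, Φ_[p/2])` is written as one function of a list `es` of sections of `E` and a
list `αs` of one-forms; `Φ_k` is its restriction to lists of lengths `p - 2k` and `k`, and `Φ` is
zero on lists of other lengths. The integer `m` is meant to be positive. -/
structure IsDiffCochain (C : CourantAlgebroid n F E) (p m : ℕ) {W : Type*} [AddCommGroup W]
    [Module ℝ W] [Module (Fun n M) W] (Φ : List (Sec n F E) → List (OneForm n M) → W) :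
    Prop where
  degree : ∀ es αs, es.length + 2 * αs.length ≠ p → Φ es αs = 0
  linear : ∀ es es' αs, IsLinearMap ℝ (fun e => Φ (es ++ e :: es') αs)
  linear_form : ∀ es αs αs', IsLinearMap ℝ (fun α => Φ es (αs ++ α :: αs'))
  symm_form : ∀ es αs αs', List.Perm αs αs' → Φ es αs = Φ es αs'
  /-- the relation
  `Φ_k(…, e, e', …; …) + Φ_k(…, e', e, …; …) = - Φ_{k+1}(…, …; d⟨e, e'⟩, …)` -/
  swap : ∀ es es' αs e e', Φ (es ++ e :: e' :: es') αs + Φ (es ++ e' :: e :: es') αs =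
    - Φ (es ++ es') (extd (C.inner e e') :: αs)
  /-- order at most `m` in each one-form -/
  order_form : ∀ es αs αs', IsDiffOp (Fun n M) m (fun α => Φ es (αs ++ α :: αs'))
  /-- order at most `m` in each section -/
  order_init : ∀ es es' αs, IsDiffOp (Fun n M) m (fun e => Φ (es ++ e :: es') αs)
  /-- order at most `m - 1` in the last section, except that for `p = 1` the unique argument is
  regarded as a first argument -/
  order_last : p ≠ 1 → ∀ es αs, IsDiffOp (Fun n M) (m - 1) (fun e => Φ (es ++ [e]) αs)

variable {FB : Type*} [NormedAddCommGroup FB] [NormedSpace ℝ FB]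
  {B : M → Type*} [TopologicalSpace (TotalSpace FB B)] [∀ x, AddCommGroup (B x)]
  [∀ x, Module ℝ (B x)] [∀ x, TopologicalSpace (B x)] [FiberBundle FB B] [VectorBundle ℝ FB B]
  [∀ x, IsTopologicalAddGroup (B x)] [∀ x, ContinuousSMul ℝ (B x)]

variable (FB B) in
/-- A predual structure on the vector bundle `B → M`: a fibrewise bilinear pairing of `E` with `B`
and a map `d_B : C^∞(M) → Γ(B)` with `⟨⟨e, d_B f⟩⟩ = ρ(e)(f)`. -/
structure Predual (C : CourantAlgebroid n F E) where
  /-- the smooth field of pairings `⟨⟨·,·⟩⟩` -/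
  pairing : Sec n (F →L[ℝ] FB →L[ℝ] ℝ) (fun x : M => E x →L[ℝ] B x →L[ℝ] Bundle.Trivial M ℝ x)
  /-- the map `d_B` -/
  dB : Fun n M → Sec n FB B
  pairing_dB : ∀ (e : Sec n F E) (f : Fun n M), pair pairing e (dB f) = C.rho e f

/-- An `E`-Dorfman connection on a predual bundle `B` of `E`. -/
structure DorfmanConnection {C : CourantAlgebroid n F E} (P : Predual FB B C) where
  /-- the `ℝ`-bilinear map `(e, b) ↦ ∇_e b` -/
  nabla : Sec n F E →ₗ[ℝ] Sec n FB B →ₗ[ℝ] Sec n FB B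
  nabla_smul_left : ∀ (f : Fun n M) (e : Sec n F E) (b : Sec n FB B),
    nabla (f • e) b = f • nabla e b + pair P.pairing e b • P.dB f
  nabla_smul_right : ∀ (f : Fun n M) (e : Sec n F E) (b : Sec n FB B),
    nabla e (f • b) = f • nabla e b + C.rho e f • b
  nabla_dB : ∀ (e : Sec n F E) (f : Fun n M), nabla e (P.dB f) = P.dB (C.rho e f)

variable (n F E FB B) in
/-- `Γ(B)`-valued cochains `H = (H_0, H_1, …)`, evaluated on lists `(e_1, …; f_1, …)` of sections of
`E` and of functions; here `H_k(…; f_1, …, f_k)` stands for the value of `H_k` on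
`(…; df_1, …, df_k)`. A section `b` of `B` is a cochain of degree zero, see `ofSection`. -/
abbrev Cochain : Type _ := List (Sec n F E) → List (Fun n M) → Sec n FB B

namespace Cochain

/-- A section of `B` as a cochain of degree zero. -/
def ofSection (b : Sec n FB B) : Cochain n F E FB B
  | [], [] => b
  | _, _ => 0

/-- The contraction `i_e`. -/
def iSec (e : Sec n F E) (H : Cochain n F E FB B) : Cochain n F E FB B :=
  fun es fs => H (e :: es) fs

/-- The contraction `i_f`. -/
def iFun (f : Fun n M) (H : Cochain n F E FB B) : Cochain n F E FB B :=
  fun es fs => H es (f :: fs)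

end Cochain

namespace DorfmanConnection

variable {C : CourantAlgebroid n F E} {P : Predual FB B C} (D : DorfmanConnection P)

/-- The Dorfman covariant derivative `d^∇` on `Γ(B)`-valued cochains of all degrees. List indices
start at `0`, so that the signs `(-1)^{i-1}` and `(-1)^i` for arguments numbered from `1` become
`(-1)^i` and `(-1)^{i+1}`. In the last sum `⟦e_i, e_j⟧` stands in the place of `e_j`, and `e_i` is
omitted. -/
def dNabla (H : Cochain n F E FB B) : Cochain n F E FB B := fun es fs =>
  (∑ μ : Fin fs.length, H (C.dE (fs.get μ) :: es) (fs.eraseIdx μ))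
  + (∑ i : Fin es.length, (-1 : ℝ) ^ (i : ℕ) • D.nabla (es.get i) (H (es.eraseIdx i) fs))
  + ∑ i : Fin es.length, ∑ j : Fin es.length,
      if i < j then
        (-1 : ℝ) ^ ((i : ℕ) + 1) •
          H ((es.set j (C.bracket (es.get i) (es.get j))).eraseIdx i) fs
      else 0

/-- The curvature `(d^∇)² b` of a section `b` of `B`. -/
def curvature (b : Sec n FB B) : Cochain n F E FB B :=
  D.dNabla (D.dNabla (Cochain.ofSection b))

end DorfmanConnection

variable (n FB B) in
/-- The space `Γ(End(B))`. -/
abbrev EndSec : Type _ := Sec n (FB →L[ℝ] FB) (fun x : M => B x →L[ℝ] B x)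

/-- The action of a section of `End(B)` on a section of `B`. -/
def EndSec.app (T : EndSec n FB B) (b : Sec n FB B) : Sec n FB B :=
  ⟨fun x => T x (b x),
    ContMDiff.clm_bundle_apply (b := fun x : M => x) T.contMDiff b.contMDiff⟩

end Courant

end Dorfman

end

/-! The curvature has degree two, so only its values on a pair of sections and on a single function
can be nonzero. Expanding `dNabla` twice gives the commutator expression `curvSec` and `∇_{d_E f}
b`. Tensoriality in b rests on two facts about the anchor. First, ρ is a bracket morphism
(`rho_bracket`), which cancels the second derivatives of a factor f in R_0(e₁, e₂)(f b). Second, ρ ∘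
ρ* = 0 (`rho_rhoStar`), which removes the derivative term in R_1. Both follow from the Courant
axioms. Bump functions then turn a C^∞(M)-linear operator on sections into a section of End(B)
(`exists_endSec_app_eq`). The exchange relation holds because the symmetric part of the bracket is
d_E⟨e₁, e₂⟩. R_0 has order one in its last argument, by a direct symbol computation
(`curvSec_smul_right`). In the first argument, exchange replaces it by R_0(e₂, e₁) and ∇ along
d_E⟨e₁, e₂⟩, and g ↦ ∇_{d_E g} b has order two. The delicate point is vanishing on Im d_B, since d_B
is not assumed additive. The rule for ∇_{fe} forces additivity and the Leibniz rule for d_B only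
after multiplication by ⟨⟨e, b⟩⟩. Near a point where all pairings vanish, d_B kills every ρ(e)(f)
instead. Together these make d_B additive on functions of the form ρ(e)(f) (`dB_rho_add`), which is
all that R_0(e₁, e₂)(d_B g) requires. -/

noncomputable section

namespace Dorfman

/-! ### Extending germs of functions and sections by bump functions -/

section SmoothExtension

open Topology

variable {n : ℕ} {M : Type*} [TopologicalSpace M] [T2Space M]
  [ChartedSpace (EuclideanSpace ℝ (Fin n)) M] [IsManifold (𝓡 n) ∞ M]
  {F : Type*} [NormedAddCommGroup F] [NormedSpace ℝ F]
  {V : M → Type*} [TopologicalSpace (TotalSpace F V)] [∀ x, AddCommGroup (V x)]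
  [∀ x, Module ℝ (V x)] [∀ x, TopologicalSpace (V x)] [FiberBundle F V] [VectorBundle ℝ F V]

/-- A smooth function equal to `1` near `x` and supported in a given neighbourhood of `x`. -/
theorem exists_bump {x : M} {u : Set M} (hu : u ∈ 𝓝 x) :
    ∃ φ : Fun n M, (∀ᶠ y in 𝓝 x, φ y = 1) ∧ tsupport φ ⊆ u := by
  obtain ⟨φ, -, hφ⟩ := (SmoothBumpFunction.nhds_basis_tsupport (I := 𝓡 n) x).mem_iff.1 hu
  exact ⟨⟨φ, φ.contMDiff⟩, φ.eventuallyEq_one, hφ⟩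

/-- Every smooth germ of a function extends to a smooth function. -/
theorem exists_fun_eventuallyEq {x : M} {u : Set M} (hu : IsOpen u) (hx : x ∈ u) {f : M → ℝ}
    (hf : ContMDiffOn (𝓡 n) 𝓘(ℝ, ℝ) ∞ f u) : ∃ g : Fun n M, ∀ᶠ y in 𝓝 x, g y = f y := by
  obtain ⟨φ, h1, hφ⟩ := exists_bump (n := n) (hu.mem_nhds hx)
  refine ⟨⟨fun y => φ y • f y, contMDiff_of_tsupport fun y hy => ?_⟩, ?_⟩
  · have hyu : y ∈ u := hφ (tsupport_smul_subset_left _ _ hy)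
    exact φ.contMDiff.contMDiffAt.smul (hf.contMDiffAt (hu.mem_nhds hyu))
  · filter_upwards [h1] with y hy
    change φ y • f y = f y
    rw [hy, one_smul]

/-- Every smooth germ of a section extends to a smooth section. -/
theorem exists_sec_eventuallyEq {x : M} {u : Set M} (hu : IsOpen u) (hx : x ∈ u)
    {s : ∀ y, V y}
    (hs : ContMDiffOn (𝓡 n) ((𝓡 n).prod 𝓘(ℝ, F)) ∞ (fun y => TotalSpace.mk' F y (s y)) u) :
    ∃ t : Sec n F V, ∀ᶠ y in 𝓝 x, t y = s y := by
  obtain ⟨φ, h1, hφ⟩ := exists_bump (n := n) (hu.mem_nhds hx)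
  refine ⟨⟨fun y => φ y • s y,
    ContMDiffOn.smul_section_of_tsupport φ.contMDiff.contMDiffOn hu hφ hs⟩, ?_⟩
  filter_upwards [h1] with y hy
  change φ y • s y = s y
  rw [hy, one_smul]

/-- For `v ≠ 0` tangent at `x` there is a smooth function with `df(v) ≠ 0`. -/
theorem eq_zero_of_extd_eq_zero {x : M} {v : TangentSpace (𝓡 n) x}
    (h : ∀ f : Fun n M, extd f x v = 0) : v = 0 := by
  have hinv := isInvertible_mfderiv_extChartAt (I := 𝓡 n) (mem_extChartAt_source (I := 𝓡 n) x)
  obtain ⟨A, hA⟩ := hinv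
  have key : mfderiv (𝓡 n) 𝓘(ℝ, EuclideanSpace ℝ (Fin n)) (extChartAt (𝓡 n) x) x v = 0 := by
    by_contra hne
    let w : EuclideanSpace ℝ (Fin n) :=
      mfderiv (𝓡 n) 𝓘(ℝ, EuclideanSpace ℝ (Fin n)) (extChartAt (𝓡 n) x) x v
    obtain ⟨l, hl⟩ : ∃ l : EuclideanSpace ℝ (Fin n) →L[ℝ] ℝ, l w ≠ 0 :=
      SeparatingDual.exists_ne_zero (x := w) hne
    -- The test function is a linear functional composed with the chart. It is smooth only on the
    -- chart domain, so a global function with the same germ at x replaces it.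
    have hc : ContMDiffOn (𝓡 n) 𝓘(ℝ, ℝ) ∞ (fun y => l (extChartAt (𝓡 n) x y))
        (chartAt (EuclideanSpace ℝ (Fin n)) x).source :=
      l.contMDiff.comp_contMDiffOn contMDiffOn_extChartAt
    obtain ⟨g, hg⟩ := exists_fun_eventuallyEq
      (chartAt (EuclideanSpace ℝ (Fin n)) x).open_source (mem_chart_source _ x) hc
    apply hl
    have h1 : mfderiv (𝓡 n) 𝓘(ℝ, ℝ) g x v = 0 := h g
    rw [Filter.EventuallyEq.mfderiv_eq (f := fun y => l (extChartAt (𝓡 n) x y)) hg] at h1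
    have h2 := mfderiv_comp (I := 𝓡 n) (I' := 𝓘(ℝ, EuclideanSpace ℝ (Fin n))) (I'' := 𝓘(ℝ, ℝ)) x
      (g := l) (f := extChartAt (𝓡 n) x) l.mdifferentiableAt
      (contMDiffAt_extChartAt (n := ∞).mdifferentiableAt (by simp))
    have h3 := DFunLike.congr_fun h2 v
    rw [ContinuousLinearMap.mfderiv_eq] at h3
    exact h3.symm.trans h1
  rw [← hA] at key
  exact (A.map_eq_zero_iff).1 key

variable [ContMDiffVectorBundle ∞ F V (𝓡 n)]

/-- Every vector of a smooth vector bundle is the value of a smooth section. -/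
theorem exists_sec_apply_eq (x : M) (v : V x) : ∃ s : Sec n F V, s x = v := by
  let e := trivializationAt F V x
  have hx : x ∈ e.baseSet := FiberBundle.mem_baseSet_trivializationAt' x
  have hs : ContMDiffOn (𝓡 n) ((𝓡 n).prod 𝓘(ℝ, F)) ∞
      (fun y => TotalSpace.mk' F y (FiberBundle.extend F v y)) e.baseSet := by
    rw [e.contMDiffOn_section_baseSet_iff]
    refine (contMDiffOn_const (c := (e ⟨x, v⟩).2)).congr fun y hy => ?_
    have h := congrArg Prod.snd (e.apply_mk_symm hy (e ⟨x, v⟩).2)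
    exact h
  obtain ⟨t, ht⟩ := exists_sec_eventuallyEq (n := n) e.open_baseSet hx hs
  exact ⟨t, ht.self_of_nhds.trans (FiberBundle.extend_apply_self F v)⟩

end SmoothExtension

/-! ### C^∞(M)-linear operators on sections as bundle endomorphisms -/

section Tensoriality

/-- A map into a space of continuous linear maps on a finite-dimensional space is smooth if its
value on each vector is. -/
theorem contMDiffAt_clm_of_apply {n : ℕ} {M : Type*} [TopologicalSpace M]
    [ChartedSpace (EuclideanSpace ℝ (Fin n)) M] {F : Type*} [NormedAddCommGroup F]
    [NormedSpace ℝ F] {G : Type*} [NormedAddCommGroup G] [NormedSpace ℝ G]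
    [FiniteDimensional ℝ F] {A : M → F →L[ℝ] G} {x : M}
    (h : ∀ v, ContMDiffAt (𝓡 n) 𝓘(ℝ, G) ∞ (fun y => A y v) x) :
    ContMDiffAt (𝓡 n) 𝓘(ℝ, F →L[ℝ] G) ∞ A x := by
  let b := Module.finBasis ℝ F
  have hA : A = fun y => ∑ i, ContinuousLinearMap.smulRightL ℝ F G
      (LinearMap.toContinuousLinearMap (b.coord i)) (A y (b i)) := by
    funext y
    ext v
    conv_lhs => rw [← b.sum_repr v, map_sum]
    simp
  rw [hA]
  exact ContMDiffAt.sum fun i _ =>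
    (ContinuousLinearMap.contMDiff _).contMDiffAt.comp x (h (b i))

open Topology

variable {n : ℕ} {M : Type*} [TopologicalSpace M] [T2Space M]
  [ChartedSpace (EuclideanSpace ℝ (Fin n)) M] [IsManifold (𝓡 n) ∞ M]
  {F : Type*} [NormedAddCommGroup F] [NormedSpace ℝ F]
  {V : M → Type*} [TopologicalSpace (TotalSpace F V)] [∀ x, AddCommGroup (V x)]
  [∀ x, Module ℝ (V x)] [∀ x, TopologicalSpace (V x)] [FiberBundle F V] [VectorBundle ℝ F V]

/-- A `C^∞(M)`-linear operator on sections is local. -/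
theorem apply_eq_zero_of_eventually_eq_zero (L : Sec n F V →ₗ[Fun n M] Sec n F V)
    {s : Sec n F V} {x : M} (h : ∀ᶠ y in 𝓝 x, s y = 0) : L s x = 0 := by
  obtain ⟨φ, h1, hφ⟩ := exists_bump (n := n) h
  -- φ is 1 near x and s vanishes on its support, so φ s = 0 and L s (x) = φ(x) L s (x) = L(φ s)(x)
  -- = 0.
  have hs : φ • s = 0 := by
    ext y
    by_cases hy : y ∈ tsupport φ
    · exact (congrArg (φ y • ·) (hφ hy)).trans (smul_zero _)
    · exact (congrArg (· • s y) (image_eq_zero_of_notMem_tsupport hy)).trans (zero_smul _ _)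
  have h2 : φ x • L s x = 0 := by
    rw [← smul_sec_apply, ← map_smul, hs, map_zero]
    rfl
  rwa [h1.self_of_nhds, one_smul] at h2

variable [FiniteDimensional ℝ F] [ContMDiffVectorBundle ∞ F V (𝓡 n)]

/-- The value of a `C^∞(M)`-linear operator at a point depends only on the value of the section. -/
theorem apply_eq_zero_of_eq_zero (L : Sec n F V →ₗ[Fun n M] Sec n F V)
    {s : Sec n F V} {x : M} (h : s x = 0) : L s x = 0 := by
  let e := trivializationAt F V x
  have hx : x ∈ e.baseSet := FiberBundle.mem_baseSet_trivializationAt' x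
  let b := Module.finBasis ℝ F
  have : ContMDiffVectorBundle 1 F V (𝓡 n) := ContMDiffVectorBundle.of_le (n := ∞) (by simp)
  choose σ hσ using fun i => exists_sec_eventuallyEq (n := n) e.open_baseSet hx
    (e.contMDiffOn_localFrame_baseSet (I := 𝓡 n) ∞ b i)
  choose c hc using fun i => exists_fun_eventuallyEq (n := n) e.open_baseSet hx
    (contMDiffOn_baseSet_localFrameCoeff (I := 𝓡 n) (k := ∞) (e := e) b
      s.contMDiff.contMDiffOn i)
  -- Frame and coefficients are replaced by global extensions of their germs. The difference from s
  -- then vanishes near x, so locality applies, and C^∞(M)-linearity handles the global sum, whose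
  -- coefficients vanish at x.
  have hev : ∀ᶠ y in 𝓝 x, (s - ∑ i, c i • σ i) y = 0 := by
    filter_upwards [Filter.eventually_all.2 hσ, Filter.eventually_all.2 hc,
      e.open_baseSet.mem_nhds hx] with y h1 h2 hy
    have h3 := e.eq_sum_localFrameCoeff_smul (I := 𝓡 n) (b := b) (s := s) hy
    have h4 : (∑ i, c i • σ i : Sec n F V) y = ∑ i, c i y • σ i y := by
      rw [← ContMDiffSection.coeAddHom_apply, map_sum, Finset.sum_apply]
      rfl
    change s y - (∑ i, c i • σ i : Sec n F V) y = 0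
    rw [sub_eq_zero, h4]
    refine h3.trans (Finset.sum_congr rfl fun i _ => ?_)
    rw [h1 i, h2 i]
    rfl
  have h5 := apply_eq_zero_of_eventually_eq_zero L hev
  have h6 : L s = L (s - ∑ i, c i • σ i) + ∑ i, c i • L (σ i) := by
    rw [map_sub, map_sum]
    simp only [map_smul, sub_add_cancel]
  have h7 : (∑ i, c i • L (σ i) : Sec n F V) x = ∑ i, c i x • L (σ i) x := by
    rw [← ContMDiffSection.coeAddHom_apply, map_sum, Finset.sum_apply]
    rfl
  rw [h6]
  change L (s - ∑ i, c i • σ i) x + (∑ i, c i • L (σ i) : Sec n F V) x = 0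
  rw [h5, h7, zero_add]
  refine Finset.sum_eq_zero fun i _ => ?_
  rw [(hc i).self_of_nhds]
  simp [h]

variable [∀ x, IsTopologicalAddGroup (V x)] [∀ x, ContinuousSMul ℝ (V x)]

/-- Every `C^∞(M)`-linear operator on sections is given by a section of the endomorphism bundle. -/
theorem exists_endSec_app_eq (L : Sec n F V →ₗ[Fun n M] Sec n F V) :
    ∃ T : EndSec n F V, ∀ s, T.app s = L s := by
  choose ext hext using fun (x : M) (v : V x) => exists_sec_apply_eq (n := n) (F := F) x v
  have hL : ∀ (x : M) (s t : Sec n F V), s x = t x → L s x = L t x := by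
    intro x s t hst
    have h := apply_eq_zero_of_eq_zero L (s := s - t) (x := x) (sub_eq_zero.2 hst)
    rw [map_sub] at h
    exact sub_eq_zero.1 h
  let A : ∀ x : M, V x →ₗ[ℝ] V x := fun x =>
    { toFun := fun v => L (ext x v) x
      map_add' := fun v w => by
        rw [hL x (ext x (v + w)) (ext x v + ext x w), map_add]
        · rfl
        · change ext x (v + w) x = ext x v x + ext x w x
          simp only [hext]
      map_smul' := fun r v => by
        let c : Fun n M := ⟨fun _ => r, contMDiff_const⟩
        rw [hL x (ext x (r • v)) (c • ext x v), map_smul]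
        · rfl
        · change ext x (r • v) x = r • ext x v x
          simp only [hext] }
  let T : ∀ x : M, V x →L[ℝ] V x := fun x =>
    have : T2Space (V x) := FiberBundle.t2Space F V x
    have : FiniteDimensional ℝ (V x) := VectorBundle.finiteDimensional ℝ F V x
    LinearMap.toContinuousLinearMap (A x)
  have hT : ∀ (x : M) (s : Sec n F V), T x (s x) = L s x := fun x s => hL x _ _ (hext x _)
  refine ⟨⟨T, fun x₀ => ?_⟩, fun s => by ext x; exact hT x s⟩
  -- Smoothness is tested on a fixed v in F. Near x₀ the section with constant coordinate v agrees
  -- with a global section t, and the coordinate expression of T applied to v is that of the smooth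
  -- section L t.
  rw [contMDiffAt_hom_bundle]
  refine ⟨contMDiffAt_id, contMDiffAt_clm_of_apply fun v => ?_⟩
  let e := trivializationAt F V x₀
  have hx₀ : x₀ ∈ e.baseSet := FiberBundle.mem_baseSet_trivializationAt' x₀
  have hs : ContMDiffOn (𝓡 n) ((𝓡 n).prod 𝓘(ℝ, F)) ∞
      (fun y => TotalSpace.mk' F y (e.symm y v)) e.baseSet := by
    rw [e.contMDiffOn_section_baseSet_iff]
    refine (contMDiffOn_const (c := v)).congr fun y hy => ?_
    exact congrArg Prod.snd (e.apply_mk_symm hy _)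
  obtain ⟨t, ht⟩ := exists_sec_eventuallyEq (n := n) e.open_baseSet hx₀ hs
  have hLt := (contMDiffAt_section (IB := 𝓡 n) (F := F) (E := V) _).1 ((L t).contMDiff x₀)
  refine hLt.congr_of_eventuallyEq ?_
  filter_upwards [ht, e.open_baseSet.mem_nhds hx₀] with y hy hye
  change ContinuousLinearMap.inCoordinates F V F V x₀ y x₀ y (T y) v = (e ⟨y, L t y⟩).2
  rw [ContinuousLinearMap.inCoordinates_eq hye hye, ← hT, hy]
  rfl

end Tensoriality

/-! ### Bilinearity of pairings on sections -/

section Pairing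

variable {n : ℕ} {M : Type*} [TopologicalSpace M] [ChartedSpace (EuclideanSpace ℝ (Fin n)) M]
  {F : Type*} [NormedAddCommGroup F] [NormedSpace ℝ F]
  {V : M → Type*} [TopologicalSpace (TotalSpace F V)] [∀ x, AddCommGroup (V x)]
  [∀ x, Module ℝ (V x)] [∀ x, TopologicalSpace (V x)] [FiberBundle F V] [VectorBundle ℝ F V]
  {F' : Type*} [NormedAddCommGroup F'] [NormedSpace ℝ F']
  {V' : M → Type*} [TopologicalSpace (TotalSpace F' V')] [∀ x, AddCommGroup (V' x)]
  [∀ x, Module ℝ (V' x)] [∀ x, TopologicalSpace (V' x)] [FiberBundle F' V']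
  [VectorBundle ℝ F' V']
  (g : Sec n (F →L[ℝ] F' →L[ℝ] ℝ) (fun x : M => V x →L[ℝ] V' x →L[ℝ] Bundle.Trivial M ℝ x))

theorem pair_add_left (s s' : Sec n F V) (t : Sec n F' V') :
    pair g (s + s') t = pair g s t + pair g s' t := by
  ext x
  change g x (s x + s' x) (t x) = g x (s x) (t x) + g x (s' x) (t x)
  rw [map_add]
  rfl

theorem pair_smul_left (f : Fun n M) (s : Sec n F V) (t : Sec n F' V') :
    pair g (f • s) t = f * pair g s t := by
  ext x
  change g x (f x • s x) (t x) = f x * g x (s x) (t x)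
  rw [map_smul]
  rfl

end Pairing

/-! ### Leibniz rule for the differential -/

section Differential

variable {n : ℕ} {M : Type*} [TopologicalSpace M] [ChartedSpace (EuclideanSpace ℝ (Fin n)) M]

theorem Fun.mdifferentiableAt (f : Fun n M) (x : M) : MDifferentiableAt (𝓡 n) 𝓘(ℝ, ℝ) f x :=
  f.contMDiff.mdifferentiableAt (by simp)

variable [IsManifold (𝓡 n) ∞ M]

theorem extd_mul (f g : Fun n M) : extd (f * g) = f • extd g + g • extd f := by
  refine ContMDiffSection.ext fun x => ?_
  exact ((f.mdifferentiableAt x).hasMFDerivAt.mul (g.mdifferentiableAt x).hasMFDerivAt).mfderiv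

end Differential

/-! ### Anchor identities implied by the Courant algebroid axioms -/

section Anchor

variable {n : ℕ} {M : Type*} [TopologicalSpace M] [ChartedSpace (EuclideanSpace ℝ (Fin n)) M]
  [IsManifold (𝓡 n) ∞ M]
  {F : Type*} [NormedAddCommGroup F] [NormedSpace ℝ F]
  {E : M → Type*} [TopologicalSpace (TotalSpace F E)] [∀ x, AddCommGroup (E x)]
  [∀ x, Module ℝ (E x)] [∀ x, TopologicalSpace (E x)] [FiberBundle F E] [VectorBundle ℝ F E]

namespace CourantData

variable (C : CourantData n F E)

theorem rho_add_left (e e' : Sec n F E) (f : Fun n M) :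
    C.rho (e + e') f = C.rho e f + C.rho e' f := by
  ext x
  change extd f x (C.anchor x (e x + e' x)) = extd f x (C.anchor x (e x)) +
    extd f x (C.anchor x (e' x))
  rw [map_add, map_add]

theorem rho_smul_left (h : Fun n M) (e : Sec n F E) (f : Fun n M) :
    C.rho (h • e) f = h * C.rho e f := by
  ext x
  change extd f x (C.anchor x (h x • e x)) = h x * extd f x (C.anchor x (e x))
  rw [map_smul, map_smul]
  rfl

theorem rho_zero_left (f : Fun n M) : C.rho 0 f = 0 := by
  simpa using C.rho_smul_left 0 0 f

theorem rho_mul (e : Sec n F E) (f g : Fun n M) :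
    C.rho e (f * g) = f * C.rho e g + g * C.rho e f := by
  ext x
  change extd (f * g) x (C.anchor x (e x)) = _
  rw [extd_mul]
  rfl

theorem rho_apply_eq_zero {e : Sec n F E} {x : M} (h : e x = 0) (f : Fun n M) :
    C.rho e f x = 0 := by
  change extd f x (C.anchor x (e x)) = 0
  rw [h, map_zero, map_zero]

theorem inner_comm (e e' : Sec n F E) : C.inner e e' = C.inner e' e := by
  ext x
  exact C.metric_symm x _ _

theorem inner_add_left (e e' t : Sec n F E) :
    C.inner (e + e') t = C.inner e t + C.inner e' t := pair_add_left _ _ _ _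

theorem inner_smul_left (f : Fun n M) (e t : Sec n F E) :
    C.inner (f • e) t = f * C.inner e t := pair_smul_left _ _ _ _

theorem eq_of_metric_eq {e e' : Sec n F E}
    (h : ∀ (x : M) (w : E x), C.metric x (e x) w = C.metric x (e' x) w) : e = e' := by
  ext x
  refine sub_eq_zero.1 (C.metric_nondeg x _ fun w => ?_)
  rw [map_sub]
  exact sub_eq_zero.2 (h x w)

section

variable [ContMDiffVectorBundle ∞ F E (𝓡 n)] [T2Space M]

theorem eq_of_inner_eq {e e' : Sec n F E} (h : ∀ t, C.inner e t = C.inner e' t) : e = e' := by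
  refine C.eq_of_metric_eq fun x w => ?_
  obtain ⟨t, rfl⟩ := exists_sec_apply_eq (n := n) (F := F) x w
  exact DFunLike.congr_fun (h t) x

theorem exists_inner_apply_ne_zero {x : M} {v : E x} (hv : v ≠ 0) :
    ∃ e e' : Sec n F E, C.inner e e' x ≠ 0 := by
  by_contra! h
  refine hv (C.metric_nondeg x v fun w => ?_)
  obtain ⟨e, rfl⟩ := exists_sec_apply_eq (n := n) (F := F) x v
  obtain ⟨e', rfl⟩ := exists_sec_apply_eq (n := n) (F := F) x w
  exact h e e'

end

variable [FiniteDimensional ℝ F] [ContMDiffVectorBundle ∞ F E (𝓡 n)]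
  [∀ x, IsTopologicalAddGroup (E x)] [∀ x, ContinuousSMul ℝ (E x)]

theorem rhoStar_add (α β : OneForm n M) : C.rhoStar (α + β) = C.rhoStar α + C.rhoStar β := by
  refine C.eq_of_metric_eq fun x w => ?_
  rw [metric_rhoStar]
  change α x (C.anchor x w) + β x (C.anchor x w) = C.metric x (C.rhoStar α x + C.rhoStar β x) w
  rw [map_add, ← metric_rhoStar, ← metric_rhoStar]
  rfl

theorem rhoStar_smul (f : Fun n M) (α : OneForm n M) :
    C.rhoStar (f • α) = f • C.rhoStar α := by
  refine C.eq_of_metric_eq fun x w => ?_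
  rw [metric_rhoStar]
  change f x • α x (C.anchor x w) = C.metric x (f x • C.rhoStar α x) w
  rw [map_smul, ← metric_rhoStar]
  rfl

theorem rhoStar_real_smul (r : ℝ) (α : OneForm n M) :
    C.rhoStar (r • α) = r • C.rhoStar α :=
  C.rhoStar_smul ⟨fun _ => r, contMDiff_const⟩ α

theorem dE_mul (f g : Fun n M) : C.dE (f * g) = f • C.dE g + g • C.dE f := by
  rw [dE, extd_mul, rhoStar_add, rhoStar_smul, rhoStar_smul]
  rfl

end CourantData

namespace CourantAlgebroid

variable [T2Space M] [FiniteDimensional ℝ F] [ContMDiffVectorBundle ∞ F E (𝓡 n)]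
  [∀ x, IsTopologicalAddGroup (E x)] [∀ x, ContinuousSMul ℝ (E x)] (C : CourantAlgebroid n F E)

/-- Not an axiom: metric compatibility gives it after pairing with an arbitrary section, and
nondegeneracy removes the pairing. -/
theorem bracket_smul_right (e : Sec n F E) (f : Fun n M) (e' : Sec n F E) :
    C.bracket e (f • e') = f • C.bracket e e' + C.rho e f • e' := by
  refine C.eq_of_inner_eq fun t => ?_
  have h1 := C.compat e (f • e') t
  have h2 := C.compat e e' t
  rw [C.inner_smul_left, C.rho_mul, C.inner_smul_left] at h1
  rw [C.inner_add_left, C.inner_smul_left, C.inner_smul_left]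
  linear_combination f * h2 - h1

/-- The anchor intertwines the bracket with the commutator of vector fields. -/
theorem rho_bracket (e e' : Sec n F E) (f : Fun n M) :
    C.rho (C.bracket e e') f = C.rho e (C.rho e' f) - C.rho e' (C.rho e f) := by
  ext x
  by_cases hE : ∃ v : E x, v ≠ 0
  · obtain ⟨v, hv⟩ := hE
    obtain ⟨t, rfl⟩ := exists_sec_apply_eq (n := n) (F := F) x v
    -- Expanding Jacobi by the Leibniz rule and subtracting f times Jacobi for t leaves the defect
    -- of the morphism property, multiplied by t. Evaluation at x, where t is nonzero, makes it
    -- vanish.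
    have h := C.jacobi e e' (f • t)
    simp only [bracket_smul_right, map_add] at h
    have h2 : (C.rho (C.bracket e e') f - (C.rho e (C.rho e' f) - C.rho e' (C.rho e f))) • t
        = 0 := by
      have h3 := C.jacobi e e' t
      rw [h3] at h
      rw [← sub_eq_zero] at h
      rw [← neg_eq_zero, ← h]
      module
    have h4 := DFunLike.congr_fun h2 x
    exact sub_eq_zero.1 ((smul_eq_zero.1 h4).resolve_right hv)
  -- If the fibre over x is zero, every section vanishes at x, and so does every ρ(e)(f).
  · push Not at hE
    change C.rho (C.bracket e e') f x = C.rho e (C.rho e' f) x - C.rho e' (C.rho e f) x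
    rw [C.rho_apply_eq_zero (hE _), C.rho_apply_eq_zero (hE _), C.rho_apply_eq_zero (hE _),
      sub_zero]

/-- d_E⟨e, e'⟩ is the symmetrised bracket, and ρ sends the bracket to a skew commutator. -/
theorem rho_dE_inner (e e' : Sec n F E) (g : Fun n M) :
    C.rho (C.dE (C.inner e e')) g = 0 := by
  rw [← C.bracket_symm, C.rho_add_left, C.rho_bracket, C.rho_bracket]
  ring

theorem rho_dE (f g : Fun n M) : C.rho (C.dE f) g = 0 := by
  ext x
  by_cases hE : ∃ v : E x, v ≠ 0
  · obtain ⟨v, hv⟩ := hE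
    obtain ⟨e, e', hne⟩ := C.exists_inner_apply_ne_zero hv
    -- By the Leibniz rule for d_E this reads ⟨e, e'⟩ ρ(d_E f)(g) = 0, with e and e' chosen so that
    -- ⟨e, e'⟩ is nonzero at x.
    have h := C.rho_dE_inner (f • e) e' g
    rw [C.inner_smul_left, C.dE_mul, C.rho_add_left, C.rho_smul_left, C.rho_smul_left,
      C.rho_dE_inner, mul_zero, zero_add] at h
    exact (mul_eq_zero.1 (DFunLike.congr_fun h x)).resolve_left hne
  · push Not at hE
    exact C.rho_apply_eq_zero (hE _) g

theorem anchor_dE (f : Fun n M) (x : M) : C.anchor x (C.dE f x) = 0 :=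
  eq_zero_of_extd_eq_zero fun g => DFunLike.congr_fun (C.rho_dE f g) x

/-- ρ(ρ*α)(g) = ⟨ρ*α, d_E g⟩ = α(ρ(d_E g)). Since α need not be exact, the vanishing of ρ(d_E g) is
needed as a vector, not only on functions. -/
theorem rho_rhoStar (α : OneForm n M) (g : Fun n M) : C.rho (C.rhoStar α) g = 0 := by
  rw [← C.inner_dE, C.inner_comm]
  ext x
  refine (C.metric_rhoStar α x (C.dE g x)).trans ?_
  rw [anchor_dE, map_zero]
  rfl

end CourantAlgebroid

end Anchor

/-! ### Calculus of differential operators of bounded order -/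

section DifferentialOperators

variable {R : Type*} [CommRing R] {V W U : Type*} [AddCommGroup V] [Module R V]
  [AddCommGroup W] [Module R W] [AddCommGroup U] [Module R U]

theorem IsDiffOp.add {s : ℕ} {D D' : V → W} (h : IsDiffOp R s D) (h' : IsDiffOp R s D') :
    IsDiffOp R s (fun v => D v + D' v) := by
  induction s generalizing D D' with
  | zero =>
    intro f v
    simp only [h f v, h' f v, smul_add]
  | succ s ih =>
    intro f
    convert ih (h f) (h' f) using 2
    module

theorem IsDiffOp.neg {s : ℕ} {D : V → W} (h : IsDiffOp R s D) :
    IsDiffOp R s (fun v => - D v) := by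
  induction s generalizing D with
  | zero =>
    intro f v
    simp only [h f v, smul_neg]
  | succ s ih =>
    intro f
    convert ih (h f) using 2
    module

theorem isDiffOp_zero (s : ℕ) : IsDiffOp R s (fun _ : V => (0 : W)) := by
  induction s with
  | zero =>
    intro f v
    rw [smul_zero]
  | succ s ih =>
    intro f
    simpa using ih

theorem IsDiffOp.succ {s : ℕ} {D : V → W} (h : IsDiffOp R s D) : IsDiffOp R (s + 1) D := by
  induction s generalizing D with
  | zero =>
    intro f
    convert isDiffOp_zero (R := R) (V := V) (W := W) 0 using 2
    rw [h, sub_self]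
  | succ s ih => exact fun f => ih (h f)

theorem IsDiffOp.comp_linear {s : ℕ} {D : V → W} (h : IsDiffOp R s D) {l : U → V}
    (hl : ∀ (f : R) (u : U), l (f • u) = f • l u) : IsDiffOp R s (fun u => D (l u)) := by
  induction s generalizing D with
  | zero =>
    intro f u
    simp only [hl, h f (l u)]
  | succ s ih =>
    intro f
    simpa only [hl] using ih (h f)

end DifferentialOperators

/-! ### Nonvanishing of a section is an open condition -/

section NonvanishingSection

open Topology

variable {n : ℕ} {M : Type*} [TopologicalSpace M] [ChartedSpace (EuclideanSpace ℝ (Fin n)) M]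
  {F : Type*} [NormedAddCommGroup F] [NormedSpace ℝ F]
  {V : M → Type*} [TopologicalSpace (TotalSpace F V)] [∀ x, AddCommGroup (V x)]
  [∀ x, Module ℝ (V x)] [∀ x, TopologicalSpace (V x)] [FiberBundle F V] [VectorBundle ℝ F V]

theorem eventually_ne_zero_of_ne_zero {s : Sec n F V} {x : M} (h : s x ≠ 0) :
    ∀ᶠ y in 𝓝 x, s y ≠ 0 := by
  let e := trivializationAt F V x
  have hx : x ∈ e.baseSet := FiberBundle.mem_baseSet_trivializationAt' x
  have hc : ContinuousAt (fun y => (e ⟨y, s y⟩).2) x :=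
    ((contMDiffAt_section (IB := 𝓡 n) (F := F) (E := V) _).1 (s.contMDiff x)).continuousAt
  have hzero : ∀ y (hy : y ∈ e.baseSet), (e ⟨y, s y⟩).2 = 0 ↔ s y = 0 := fun y hy =>
    (e.continuousLinearEquivAt ℝ y hy).map_eq_zero_iff
  have hne : (e ⟨x, s x⟩).2 ≠ 0 := fun h0 => h ((hzero x hx).1 h0)
  filter_upwards [hc.eventually_ne hne, e.open_baseSet.mem_nhds hx] with y hy hye h0
  exact hy ((hzero y hye).2 h0)

end NonvanishingSection

/-! ### Curvature operators of a Dorfman connection: symbols, tensoriality, vanishing on Im d_B -/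

section Connection

open Topology

variable {n : ℕ} {M : Type*} [TopologicalSpace M]
  [ChartedSpace (EuclideanSpace ℝ (Fin n)) M] [IsManifold (𝓡 n) ∞ M]
  {F : Type*} [NormedAddCommGroup F] [NormedSpace ℝ F] [FiniteDimensional ℝ F]
  {E : M → Type*} [TopologicalSpace (TotalSpace F E)] [∀ x, AddCommGroup (E x)]
  [∀ x, Module ℝ (E x)] [∀ x, TopologicalSpace (E x)] [FiberBundle F E] [VectorBundle ℝ F E]
  [ContMDiffVectorBundle ∞ F E (𝓡 n)]
  [∀ x, IsTopologicalAddGroup (E x)] [∀ x, ContinuousSMul ℝ (E x)]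
  {FB : Type*} [NormedAddCommGroup FB] [NormedSpace ℝ FB]
  {B : M → Type*} [TopologicalSpace (TotalSpace FB B)] [∀ x, AddCommGroup (B x)]
  [∀ x, Module ℝ (B x)] [∀ x, TopologicalSpace (B x)] [FiberBundle FB B] [VectorBundle ℝ FB B]

namespace DorfmanConnection

variable {C : CourantAlgebroid n F E} {P : Predual FB B C}

theorem dB_zero (D : DorfmanConnection P) : P.dB 0 = 0 := by
  have h := D.nabla_dB 0 0
  rw [C.rho_zero_left, map_zero] at h
  exact h.symm

/-- Compute ∇_{(f+g)e} b in two ways. The pairing factor cannot be cancelled in general, so this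
does not give additivity of d_B itself. -/
theorem pairing_smul_dB_add (D : DorfmanConnection P) (e : Sec n F E) (b : Sec n FB B)
    (f g : Fun n M) :
    pair P.pairing e b • (P.dB (f + g) - (P.dB f + P.dB g)) = 0 := by
  have h := D.nabla_smul_left (f + g) e b
  rw [add_smul, map_add, LinearMap.add_apply, D.nabla_smul_left, D.nabla_smul_left,
    ← sub_eq_zero] at h
  rw [← neg_eq_zero, ← h]
  module

theorem pairing_smul_dB_mul (D : DorfmanConnection P) (e : Sec n F E) (b : Sec n FB B)
    (f g : Fun n M) :
    pair P.pairing e b • P.dB (f * g) = pair P.pairing e b • (f • P.dB g + g • P.dB f) := by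
  have h := D.nabla_smul_left (f * g) e b
  rw [mul_smul, D.nabla_smul_left, D.nabla_smul_left, pair_smul_left, ← sub_eq_zero] at h
  rw [← sub_eq_zero, ← neg_eq_zero, ← h]
  module

variable (D : DorfmanConnection P)

/-- The component `R_0` of the curvature. -/
def curvSec (e₁ e₂ : Sec n F E) (b : Sec n FB B) : Sec n FB B :=
  D.nabla e₁ (D.nabla e₂ b) - D.nabla e₂ (D.nabla e₁ b) - D.nabla (C.bracket e₁ e₂) b

/-- The commutators of covariant derivatives cancel, leaving only the symmetric part of the bracket.
-/
theorem curvSec_swap (e₁ e₂ : Sec n F E) (b : Sec n FB B) :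
    D.curvSec e₁ e₂ b + D.curvSec e₂ e₁ b = - D.nabla (C.dE (C.inner e₁ e₂)) b := by
  rw [← C.bracket_symm, map_add, LinearMap.add_apply, curvSec, curvSec]
  abel

theorem isDiffOp_nabla_rhoStar (b : Sec n FB B) :
    IsDiffOp (Fun n M) 1 (fun α => D.nabla (C.rhoStar α) b) := by
  intro f h α
  simp only [C.rhoStar_smul, D.nabla_smul_left, pair_smul_left]
  module

theorem isDiffOp_nabla_dE (b : Sec n FB B) :
    IsDiffOp (Fun n M) 2 (fun g : Fun n M => D.nabla (C.dE g) b) := by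
  -- The symbol at f is g ∇_{d_E f} b + ⟨⟨d_E g, b⟩⟩ d_B f + ⟨⟨d_E f, b⟩⟩ d_B g; each summand has
  -- order at most one in g.
  intro f
  have h1 : IsDiffOp (Fun n M) 1 (fun g : Fun n M => g • D.nabla (C.dE f) b) :=
    IsDiffOp.succ fun h g => by rw [smul_eq_mul, mul_smul]
  have h2 : IsDiffOp (Fun n M) 1 (fun g : Fun n M => pair P.pairing (C.dE g) b • P.dB f) := by
    intro h k g
    simp only [smul_eq_mul, C.dE_mul, pair_add_left, pair_smul_left]
    module
  have h3 : IsDiffOp (Fun n M) 1 (fun g : Fun n M => pair P.pairing (C.dE f) b • P.dB g) := by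
    intro h k g
    simp only [smul_eq_mul]
    -- The Leibniz rule for d_B is available here only because d_B g carries a pairing as
    -- coefficient.
    rw [D.pairing_smul_dB_mul _ _ h (k * g), D.pairing_smul_dB_mul _ _ h g]
    module
  convert (h1.add h2).add h3 using 2 with g
  simp only [smul_eq_mul, C.dE_mul, map_add, LinearMap.add_apply, D.nabla_smul_left]
  module

variable [T2Space M]

/-- On the interior of the zero set of the pairing, `d_B` vanishes on all `ρ(e)(f)`. -/
theorem dB_rho_apply_eq_zero (D : DorfmanConnection P) {x : M}
    (hx : ∀ᶠ y in 𝓝 x, ∀ (e : Sec n F E) (b : Sec n FB B), pair P.pairing e b y = 0)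
    (e : Sec n F E) (f : Fun n M) : P.dB (C.rho e f) x = 0 := by
  obtain ⟨φ, h1, hφ⟩ := exists_bump (n := n) hx
  have hz : φ * C.rho e f = 0 := by
    ext y
    by_cases hy : y ∈ tsupport φ
    · have h := hφ hy e (P.dB f)
      rw [P.pairing_dB] at h
      exact (congrArg (φ y * ·) h).trans (mul_zero _)
    · exact (congrArg (· * C.rho e f y) (image_eq_zero_of_notMem_tsupport hy)).trans (zero_mul _)
  have h := D.nabla_smul_left φ e (P.dB f)
  -- ∇_{φe}(d_B f) equals d_B(φ ρ(e)(f)) = d_B 0 = 0, because ρ(e)(f) = ⟨⟨e, d_B f⟩⟩ vanishes on the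
  -- support of φ. The product rule evaluates the same expression at x to d_B(ρ(e)(f)).
  rw [D.nabla_dB, D.nabla_dB, C.rho_smul_left, hz, D.dB_zero] at h
  have h2 : (0 : B x) = φ x • P.dB (C.rho e f) x + pair P.pairing e (P.dB f) x • P.dB φ x :=
    DFunLike.congr_fun h x
  rw [h1.self_of_nhds, hx.self_of_nhds e (P.dB f), one_smul, zero_smul, add_zero] at h2
  exact h2.symm

/-- `d_B` is additive on functions of the form `ρ(e)(f)`. -/
theorem dB_rho_add (D : DorfmanConnection P) {e₁ e₂ e₃ : Sec n F E} {f₁ f₂ f₃ : Fun n M}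
    (h : C.rho e₃ f₃ = C.rho e₁ f₁ + C.rho e₂ f₂) :
    P.dB (C.rho e₃ f₃) = P.dB (C.rho e₁ f₁) + P.dB (C.rho e₂ f₂) := by
  rw [← sub_eq_zero]
  by_contra hne
  obtain ⟨x, hx⟩ : ∃ x,
      (P.dB (C.rho e₃ f₃) - (P.dB (C.rho e₁ f₁) + P.dB (C.rho e₂ f₂))) x ≠ 0 := by
    by_contra! h0
    exact hne (ContMDiffSection.ext h0)
  -- The defect of additivity is nonzero near x, yet every pairing multiplies it to zero, so all
  -- pairings vanish near x. Each of the three terms is then zero at x.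
  have hp : ∀ᶠ y in 𝓝 x, ∀ (e : Sec n F E) (b : Sec n FB B), pair P.pairing e b y = 0 := by
    filter_upwards [eventually_ne_zero_of_ne_zero hx] with y hy e b
    have h0 := D.pairing_smul_dB_add e b (C.rho e₁ f₁) (C.rho e₂ f₂)
    rw [← h] at h0
    exact (smul_eq_zero.1 (DFunLike.congr_fun h0 y)).resolve_right hy
  apply hx
  change P.dB (C.rho e₃ f₃) x - (P.dB (C.rho e₁ f₁) x + P.dB (C.rho e₂ f₂) x) = 0
  rw [D.dB_rho_apply_eq_zero hp, D.dB_rho_apply_eq_zero hp, D.dB_rho_apply_eq_zero hp, add_zero,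
    sub_zero]

/-- The component `R_0` of the curvature, as a `C^∞(M)`-linear operator. -/
def curvSecHom (e₁ e₂ : Sec n F E) : Sec n FB B →ₗ[Fun n M] Sec n FB B where
  toFun := D.curvSec e₁ e₂
  map_add' b b' := by
    simp only [curvSec, map_add]
    abel
  map_smul' f b := by
    simp only [curvSec, D.nabla_smul_right, map_add, C.rho_bracket, RingHom.id_apply]
    module

/-- The component `R_1` of the curvature, as a `C^∞(M)`-linear operator. -/
def curvFormHom (α : OneForm n M) : Sec n FB B →ₗ[Fun n M] Sec n FB B where
  toFun := D.nabla (C.rhoStar α)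
  map_add' b b' := map_add _ _ _
  map_smul' f b := by
    rw [D.nabla_smul_right, C.rho_rhoStar, zero_smul, add_zero, RingHom.id_apply]

theorem curvSecHom_apply (e₁ e₂ : Sec n F E) (b : Sec n FB B) :
    D.curvSecHom e₁ e₂ b = D.curvSec e₁ e₂ b := rfl

theorem curvSec_dB (e₁ e₂ : Sec n F E) (g : Fun n M) : D.curvSec e₁ e₂ (P.dB g) = 0 := by
  simp only [curvSec, D.nabla_dB]
  rw [D.dB_rho_add (e₁ := e₂) (f₁ := C.rho e₁ g) (e₂ := C.bracket e₁ e₂) (f₂ := g)]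
  · abel
  · rw [C.rho_bracket]
    ring

theorem nabla_rhoStar_dB (α : OneForm n M) (g : Fun n M) :
    D.nabla (C.rhoStar α) (P.dB g) = 0 := by
  rw [D.nabla_dB, C.rho_rhoStar, D.dB_zero]

/-- The terms ⟨⟨e₂, b⟩⟩ d_B(ρ(e₁)(f)), from ∇_{e₁} of d_B f and from the bracket, cancel. Only d_B f
survives. -/
theorem curvSec_smul_right (f : Fun n M) (e₁ e₂ : Sec n F E) (b : Sec n FB B) :
    D.curvSec e₁ (f • e₂) b = f • D.curvSec e₁ e₂ b +
      (C.rho e₁ (pair P.pairing e₂ b) - pair P.pairing e₂ (D.nabla e₁ b)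
        - pair P.pairing (C.bracket e₁ e₂) b) • P.dB f := by
  simp only [curvSec, D.nabla_smul_left, D.nabla_smul_right, C.bracket_smul_right, map_add,
    LinearMap.add_apply, D.nabla_dB]
  module

theorem isDiffOp_curvSec_right (e₁ : Sec n F E) (b : Sec n FB B) :
    IsDiffOp (Fun n M) 1 (fun e₂ => D.curvSec e₁ e₂ b) := by
  intro f h e₂
  -- The coefficient of d_B f is C^∞(M)-linear in e₂: the two occurrences of ρ(e₁)(h) ⟨⟨e₂, b⟩⟩
  -- cancel.
  simp only [curvSec_smul_right, pair_smul_left, C.rho_mul, C.bracket_smul_right, pair_add_left]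
  module

/-- Exchange gives R_0(e₁, e₂) = -R_0(e₂, e₁) - ∇_{d_E⟨e₁, e₂⟩}. The last term is a second-order
operator composed with the linear map e₁ ↦ ⟨e₁, e₂⟩, which is where order two arises. -/
theorem isDiffOp_curvSec_left (e₂ : Sec n F E) (b : Sec n FB B) :
    IsDiffOp (Fun n M) 2 (fun e₁ => D.curvSec e₁ e₂ b) := by
  have h1 := (D.isDiffOp_curvSec_right e₂ b).succ.neg
  have h2 := ((D.isDiffOp_nabla_dE b).comp_linear (l := fun e => C.inner e e₂)
    fun f e => C.inner_smul_left f e e₂).neg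
  convert h2.add h1 using 2 with e
  rw [← curvSec_swap]
  abel

end DorfmanConnection

end Connection

/-! ### Testing sections of End(B) on sections of B -/

section EndomorphismSections

variable {n : ℕ} {M : Type*} [TopologicalSpace M] [ChartedSpace (EuclideanSpace ℝ (Fin n)) M]
  {F : Type*} [NormedAddCommGroup F] [NormedSpace ℝ F]
  {V : M → Type*} [TopologicalSpace (TotalSpace F V)] [∀ x, AddCommGroup (V x)]
  [∀ x, Module ℝ (V x)] [∀ x, TopologicalSpace (V x)] [FiberBundle F V] [VectorBundle ℝ F V]
  [∀ x, IsTopologicalAddGroup (V x)] [∀ x, ContinuousSMul ℝ (V x)]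

theorem EndSec.zero_app (b : Sec n F V) : (0 : EndSec n F V).app b = 0 := rfl

theorem EndSec.neg_app (T : EndSec n F V) (b : Sec n F V) : (-T).app b = -T.app b := rfl

theorem EndSec.add_app (T T' : EndSec n F V) (b : Sec n F V) :
    (T + T').app b = T.app b + T'.app b := rfl

theorem EndSec.real_smul_app (r : ℝ) (T : EndSec n F V) (b : Sec n F V) :
    (r • T).app b = r • T.app b := rfl

variable [T2Space M] [IsManifold (𝓡 n) ∞ M] [ContMDiffVectorBundle ∞ F V (𝓡 n)]

theorem EndSec.ext_app {T T' : EndSec n F V} (h : ∀ b, T.app b = T'.app b) : T = T' := by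
  refine ContMDiffSection.ext fun x => ContinuousLinearMap.ext fun v => ?_
  obtain ⟨b, rfl⟩ := exists_sec_apply_eq (n := n) (F := F) x v
  exact DFunLike.congr_fun (h b) x

theorem isDiffOp_of_app {U : Type*} [AddCommGroup U] [Module (Fun n M) U] {s : ℕ}
    {D : U → EndSec n F V} (h : ∀ b, IsDiffOp (Fun n M) s (fun u => (D u).app b)) :
    IsDiffOp (Fun n M) s D := by
  induction s generalizing D with
  | zero => exact fun f u => EndSec.ext_app fun b => h b f u
  | succ s ih => exact fun f => ih fun b => h b f

end EndomorphismSections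

/-! ### Argument lists of total degree two -/

section Degree

theorem eq_pair_or_singleton_of_length_eq_two {α β : Type*} {es : List α} {αs : List β}
    (h : es.length + 2 * αs.length = 2) :
    (∃ e₁ e₂, es = [e₁, e₂] ∧ αs = []) ∨ ∃ a, es = [] ∧ αs = [a] := by
  match es, αs, h with
  | [e₁, e₂], [], _ => exact .inl ⟨e₁, e₂, rfl, rfl⟩
  | [], [a], _ => exact .inr ⟨a, rfl, rfl⟩
  | [], _ :: _ :: _, h => simp at h
  | [_], _ , h => simp at h; omega
  | _ :: _ :: _ :: _, _, h => simp at h; omega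
  | [_, _], _ :: _, h => simp at h

/-- A list of total degree two with a marked entry `e` has the form `[e, a]` or `[a, e]`. -/
theorem eq_singleton_of_length_append_cons_eq_two {α β : Type*} {es es' : List α} {αs : List β}
    (h : es.length + es'.length + 1 + 2 * αs.length = 2) :
    αs = [] ∧ ((∃ a, es = [] ∧ es' = [a]) ∨ ∃ a, es = [a] ∧ es' = []) := by
  have h0 : αs = [] := List.length_eq_zero_iff.1 (by omega)
  refine ⟨h0, ?_⟩
  rw [h0, List.length_nil] at h
  obtain h1 | h1 : es.length = 0 ∨ es.length = 1 := by omega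
  · obtain ⟨a, ha⟩ := List.length_eq_one_iff.1 (show es'.length = 1 by omega)
    exact .inl ⟨a, List.length_eq_zero_iff.1 h1, ha⟩
  · obtain ⟨a, ha⟩ := List.length_eq_one_iff.1 h1
    exact .inr ⟨a, ha, List.length_eq_zero_iff.1 (by omega)⟩

/-- A list of total degree two with a marked form is the singleton of that form. -/
theorem eq_nil_of_two_mul_length_append_cons_eq_two {α β : Type*} {es : List α} {αs αs' : List β}
    (h : es.length + 2 * (αs.length + αs'.length + 1) = 2) : es = [] ∧ αs = [] ∧ αs' = [] :=
  ⟨List.length_eq_zero_iff.1 (by omega), List.length_eq_zero_iff.1 (by omega),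
    List.length_eq_zero_iff.1 (by omega)⟩

variable {n : ℕ} {M : Type*} [TopologicalSpace M] [ChartedSpace (EuclideanSpace ℝ (Fin n)) M]
  {F : Type*} [NormedAddCommGroup F] [NormedSpace ℝ F]
  {E : M → Type*} [TopologicalSpace (TotalSpace F E)] [∀ x, TopologicalSpace (E x)]
  [FiberBundle F E]
  {FB : Type*} [NormedAddCommGroup FB] [NormedSpace ℝ FB]
  {B : M → Type*} [TopologicalSpace (TotalSpace FB B)] [∀ x, AddCommGroup (B x)]
  [∀ x, Module ℝ (B x)] [∀ x, TopologicalSpace (B x)] [FiberBundle FB B] [VectorBundle ℝ FB B]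

theorem Cochain.ofSection_eq_zero (b : Sec n FB B) {es : List (Sec n F E)} {fs : List (Fun n M)}
    (h : es.length + 2 * fs.length ≠ 0) : Cochain.ofSection b es fs = 0 := by
  match es, fs, h with
  | [], [], h => exact absurd rfl h
  | [], _ :: _, _ => rfl
  | _ :: _, _, _ => rfl

end Degree

/-! ### The curvature as a cochain with values in End(B) -/

section Curvature

variable {n : ℕ} {M : Type*} [TopologicalSpace M]
  [ChartedSpace (EuclideanSpace ℝ (Fin n)) M] [IsManifold (𝓡 n) ∞ M]
  {F : Type*} [NormedAddCommGroup F] [NormedSpace ℝ F] [FiniteDimensional ℝ F]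
  {E : M → Type*} [TopologicalSpace (TotalSpace F E)] [∀ x, AddCommGroup (E x)]
  [∀ x, Module ℝ (E x)] [∀ x, TopologicalSpace (E x)] [FiberBundle F E] [VectorBundle ℝ F E]
  [ContMDiffVectorBundle ∞ F E (𝓡 n)]
  [∀ x, IsTopologicalAddGroup (E x)] [∀ x, ContinuousSMul ℝ (E x)]
  {FB : Type*} [NormedAddCommGroup FB] [NormedSpace ℝ FB]
  {B : M → Type*} [TopologicalSpace (TotalSpace FB B)] [∀ x, AddCommGroup (B x)]
  [∀ x, Module ℝ (B x)] [∀ x, TopologicalSpace (B x)] [FiberBundle FB B] [VectorBundle ℝ FB B]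

namespace DorfmanConnection

variable {C : CourantAlgebroid n F E} {P : Predual FB B C} (D : DorfmanConnection P)

/-- The covariant derivative raises the degree of a cochain by one. -/
theorem dNabla_eq_zero {H : Cochain n F E FB B} {p : ℕ}
    (hH : ∀ es fs, es.length + 2 * fs.length ≠ p → H es fs = 0)
    {es : List (Sec n F E)} {fs : List (Fun n M)} (h : es.length + 2 * fs.length ≠ p + 1) :
    D.dNabla H es fs = 0 := by
  unfold dNabla
  -- Each sum evaluates H in total degree one lower: a function of degree two is traded for a
  -- section of degree one, or one section is removed.
  rw [Finset.sum_eq_zero, Finset.sum_eq_zero, Finset.sum_eq_zero, add_zero, add_zero]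
  · intro i _
    refine Finset.sum_eq_zero fun j _ => ?_
    have hi := i.2
    rw [hH _ _ (by rw [List.length_eraseIdx_of_lt (by simp), List.length_set]; omega), smul_zero,
      ite_self]
  · intro i _
    have hi := i.2
    rw [hH _ _ (by rw [List.length_eraseIdx_of_lt i.2]; omega), map_zero, smul_zero]
  · intro μ _
    have hμ := μ.2
    exact hH _ _ (by rw [List.length_eraseIdx_of_lt μ.2, List.length_cons]; omega)

theorem dNabla_ofSection_eq_zero (b : Sec n FB B) {es : List (Sec n F E)} {fs : List (Fun n M)}
    (h : es.length + 2 * fs.length ≠ 1) : D.dNabla (Cochain.ofSection b) es fs = 0 :=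
  D.dNabla_eq_zero (p := 0) (fun _ _ => Cochain.ofSection_eq_zero b) h

theorem dNabla_ofSection_singleton (b : Sec n FB B) (e : Sec n F E) :
    D.dNabla (Cochain.ofSection b) [e] [] = D.nabla e b := by
  simp [dNabla, Cochain.ofSection]

theorem curvature_eq_zero (b : Sec n FB B) {es : List (Sec n F E)} {fs : List (Fun n M)}
    (h : es.length + 2 * fs.length ≠ 2) : D.curvature b es fs = 0 :=
  D.dNabla_eq_zero (p := 1) (fun _ _ => D.dNabla_ofSection_eq_zero b) h

theorem curvature_pair (b : Sec n FB B) (e₁ e₂ : Sec n F E) :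
    D.curvature b [e₁, e₂] [] = D.curvSec e₁ e₂ b := by
  unfold curvature
  rw [dNabla]
  simp [Fin.sum_univ_succ, dNabla_ofSection_singleton, curvSec, sub_eq_add_neg]

theorem curvature_singleton (b : Sec n FB B) (f : Fun n M) :
    D.curvature b [] [f] = D.nabla (C.dE f) b := by
  unfold curvature
  rw [dNabla]
  simp [dNabla_ofSection_singleton]

/-- Beyond the value on a pair, the equality of cochains says that the curvature vanishes on all
longer argument lists, by degree. -/
theorem iSec_iSec_curvature (e₁ e₂ : Sec n F E) (b : Sec n FB B) :
    ((D.curvature b).iSec e₁).iSec e₂ = Cochain.ofSection (D.curvSec e₁ e₂ b) := by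
  funext es fs
  change D.curvature b (e₁ :: e₂ :: es) fs = _
  by_cases h : es.length + 2 * fs.length = 0
  · obtain rfl : es = [] := List.length_eq_zero_iff.1 (by omega)
    obtain rfl : fs = [] := List.length_eq_zero_iff.1 (by omega)
    exact D.curvature_pair b e₁ e₂
  · rw [Cochain.ofSection_eq_zero _ h, D.curvature_eq_zero]
    simp only [List.length_cons]
    omega

theorem iFun_curvature (f : Fun n M) (b : Sec n FB B) :
    (D.curvature b).iFun f = Cochain.ofSection (D.nabla (C.dE f) b) := by
  funext es fs
  change D.curvature b es (f :: fs) = _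
  by_cases h : es.length + 2 * fs.length = 0
  · obtain rfl : es = [] := List.length_eq_zero_iff.1 (by omega)
    obtain rfl : fs = [] := List.length_eq_zero_iff.1 (by omega)
    exact D.curvature_singleton b f
  · rw [Cochain.ofSection_eq_zero _ h, D.curvature_eq_zero]
    simp only [List.length_cons]
    omega

section

variable [T2Space M]

theorem isLinearMap_curvature : IsLinearMap (Fun n M) D.curvature where
  map_add b b' := by
    funext es fs
    change D.curvature (b + b') es fs = D.curvature b es fs + D.curvature b' es fs
    by_cases h : es.length + 2 * fs.length = 2
    · obtain ⟨e₁, e₂, rfl, rfl⟩ | ⟨f, rfl, rfl⟩ := eq_pair_or_singleton_of_length_eq_two h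
      · simp only [curvature_pair, ← curvSecHom_apply, map_add]
      · simp only [curvature_singleton, map_add]
    · simp only [D.curvature_eq_zero _ h, add_zero]
  map_smul g b := by
    funext es fs
    change D.curvature (g • b) es fs = g • D.curvature b es fs
    by_cases h : es.length + 2 * fs.length = 2
    · obtain ⟨e₁, e₂, rfl, rfl⟩ | ⟨f, rfl, rfl⟩ := eq_pair_or_singleton_of_length_eq_two h
      · simp only [curvature_pair, ← curvSecHom_apply, map_smul]
      · rw [curvature_singleton, curvature_singleton]
        exact (D.curvFormHom (extd f)).map_smul g b
    · simp only [D.curvature_eq_zero _ h, smul_zero]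

end

variable [T2Space M] [FiniteDimensional ℝ FB] [ContMDiffVectorBundle ∞ FB B (𝓡 n)]
  [∀ x, IsTopologicalAddGroup (B x)] [∀ x, ContinuousSMul ℝ (B x)]

/-- The curvature as a cochain with values in `Γ(End(B))`. -/
def curvEnd : List (Sec n F E) → List (OneForm n M) → EndSec n FB B
  | [e₁, e₂], [] => (exists_endSec_app_eq (D.curvSecHom e₁ e₂)).choose
  | [], [α] => (exists_endSec_app_eq (D.curvFormHom α)).choose
  | _, _ => 0

theorem curvEnd_pair_app (e₁ e₂ : Sec n F E) (b : Sec n FB B) :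
    (D.curvEnd [e₁, e₂] []).app b = D.curvSec e₁ e₂ b :=
  (exists_endSec_app_eq (D.curvSecHom e₁ e₂)).choose_spec b

theorem curvEnd_singleton_app (α : OneForm n M) (b : Sec n FB B) :
    (D.curvEnd [] [α]).app b = D.nabla (C.rhoStar α) b :=
  (exists_endSec_app_eq (D.curvFormHom α)).choose_spec b

theorem curvEnd_eq_zero {es : List (Sec n F E)} {αs : List (OneForm n M)}
    (h : es.length + 2 * αs.length ≠ 2) : D.curvEnd es αs = 0 := by
  match es, αs, h with
  | [_, _], [], h => exact absurd rfl h
  | [], [_], h => exact absurd rfl h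
  | [], [], _ => rfl
  | [], _ :: _ :: _, _ => rfl
  | [_], _, _ => rfl
  | _ :: _ :: _ :: _, _, _ => rfl
  | [_, _], _ :: _, _ => rfl

theorem curvEnd_app_dB (es : List (Sec n F E)) (αs : List (OneForm n M)) (g : Fun n M) :
    (D.curvEnd es αs).app (P.dB g) = 0 := by
  by_cases h : es.length + 2 * αs.length = 2
  · obtain ⟨e₁, e₂, rfl, rfl⟩ | ⟨α, rfl, rfl⟩ := eq_pair_or_singleton_of_length_eq_two h
    · rw [curvEnd_pair_app, curvSec_dB]
    · rw [curvEnd_singleton_app, nabla_rhoStar_dB]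
  · rw [D.curvEnd_eq_zero h, EndSec.zero_app]

theorem curvEnd_map_extd_app (b : Sec n FB B) (es : List (Sec n F E)) (fs : List (Fun n M)) :
    (D.curvEnd es (fs.map extd)).app b = D.curvature b es fs := by
  by_cases h : es.length + 2 * fs.length = 2
  · obtain ⟨e₁, e₂, rfl, rfl⟩ | ⟨α, rfl, rfl⟩ := eq_pair_or_singleton_of_length_eq_two h
    · rw [curvature_pair]
      exact D.curvEnd_pair_app e₁ e₂ b
    · rw [curvature_singleton]
      exact D.curvEnd_singleton_app _ b
  · rw [D.curvature_eq_zero b h, D.curvEnd_eq_zero (by simpa using h), EndSec.zero_app]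

theorem isLinearMap_curvEnd (es es' : List (Sec n F E)) (αs : List (OneForm n M)) :
    IsLinearMap ℝ (fun e => D.curvEnd (es ++ e :: es') αs) := by
  by_cases h : es.length + es'.length + 1 + 2 * αs.length = 2
  · obtain ⟨rfl, ⟨a, rfl, rfl⟩ | ⟨a, rfl, rfl⟩⟩ := eq_singleton_of_length_append_cons_eq_two h
    · constructor
      · refine fun u v => EndSec.ext_app fun b => ?_
        simp only [List.nil_append, EndSec.add_app, curvEnd_pair_app, curvSec, map_add,
          LinearMap.add_apply]
        abel
      · refine fun r u => EndSec.ext_app fun b => ?_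
        simp only [List.nil_append, EndSec.real_smul_app, curvEnd_pair_app, curvSec, map_smul,
          LinearMap.smul_apply, smul_sub]
    · constructor
      · refine fun u v => EndSec.ext_app fun b => ?_
        simp only [List.cons_append, List.nil_append, EndSec.add_app, curvEnd_pair_app, curvSec,
          map_add, LinearMap.add_apply]
        abel
      · refine fun r u => EndSec.ext_app fun b => ?_
        simp only [List.cons_append, List.nil_append, EndSec.real_smul_app, curvEnd_pair_app,
          curvSec, map_smul, LinearMap.smul_apply, smul_sub]
  · have h0 : ∀ e, D.curvEnd (es ++ e :: es') αs = 0 := fun e =>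
      D.curvEnd_eq_zero (by rw [List.length_append, List.length_cons]; omega)
    simp only [h0]
    exact (0 : Sec n F E →ₗ[ℝ] EndSec n FB B).isLinear

theorem isLinearMap_curvEnd_form (es : List (Sec n F E)) (αs αs' : List (OneForm n M)) :
    IsLinearMap ℝ (fun α => D.curvEnd es (αs ++ α :: αs')) := by
  by_cases h : es.length + 2 * (αs.length + αs'.length + 1) = 2
  · obtain ⟨rfl, rfl, rfl⟩ := eq_nil_of_two_mul_length_append_cons_eq_two h
    constructor
    · refine fun u v => EndSec.ext_app fun b => ?_
      simp only [List.nil_append, EndSec.add_app, curvEnd_singleton_app, C.rhoStar_add, map_add,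
        LinearMap.add_apply]
    · refine fun r u => EndSec.ext_app fun b => ?_
      simp only [List.nil_append, EndSec.real_smul_app, curvEnd_singleton_app,
        C.rhoStar_real_smul, map_smul, LinearMap.smul_apply]
  · have h0 : ∀ α, D.curvEnd es (αs ++ α :: αs') = 0 := fun e =>
      D.curvEnd_eq_zero (by rw [List.length_append, List.length_cons]; omega)
    simp only [h0]
    exact (0 : OneForm n M →ₗ[ℝ] EndSec n FB B).isLinear

theorem curvEnd_perm (es : List (Sec n F E)) {αs αs' : List (OneForm n M)}
    (h : List.Perm αs αs') : D.curvEnd es αs = D.curvEnd es αs' := by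
  by_cases hl : es.length + 2 * αs.length = 2
  · obtain ⟨_, _, rfl, rfl⟩ | ⟨α, rfl, rfl⟩ := eq_pair_or_singleton_of_length_eq_two hl
    · rw [List.nil_perm.1 h]
    · rw [List.singleton_perm.1 h]
  · rw [D.curvEnd_eq_zero hl, D.curvEnd_eq_zero (h.length_eq ▸ hl)]

theorem curvEnd_swap (es es' : List (Sec n F E)) (αs : List (OneForm n M)) (e e' : Sec n F E) :
    D.curvEnd (es ++ e :: e' :: es') αs + D.curvEnd (es ++ e' :: e :: es') αs =
      - D.curvEnd (es ++ es') (extd (C.inner e e') :: αs) := by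
  -- Both sides have degree two exactly when the remaining arguments are empty; otherwise all three
  -- terms vanish by degree.
  by_cases h : es.length + es'.length + 2 * αs.length = 0
  · obtain rfl : es = [] := List.length_eq_zero_iff.1 (by omega)
    obtain rfl : es' = [] := List.length_eq_zero_iff.1 (by omega)
    obtain rfl : αs = [] := List.length_eq_zero_iff.1 (by omega)
    refine EndSec.ext_app fun b => ?_
    rw [EndSec.add_app, EndSec.neg_app, List.nil_append, List.nil_append, List.nil_append,
      curvEnd_pair_app, curvEnd_pair_app, curvEnd_singleton_app, curvSec_swap]
    rfl
  · rw [D.curvEnd_eq_zero, D.curvEnd_eq_zero, D.curvEnd_eq_zero, add_zero, neg_zero] <;>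
      simp only [List.length_append, List.length_cons] <;> omega

theorem isDiffOp_curvEnd_form (es : List (Sec n F E)) (αs αs' : List (OneForm n M)) :
    IsDiffOp (Fun n M) 2 (fun α => D.curvEnd es (αs ++ α :: αs')) := by
  by_cases h : es.length + 2 * (αs.length + αs'.length + 1) = 2
  · obtain ⟨rfl, rfl, rfl⟩ := eq_nil_of_two_mul_length_append_cons_eq_two h
    refine isDiffOp_of_app fun b => ?_
    simpa only [List.nil_append, curvEnd_singleton_app] using (D.isDiffOp_nabla_rhoStar b).succ
  · have h0 : ∀ α, D.curvEnd es (αs ++ α :: αs') = 0 := fun e =>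
      D.curvEnd_eq_zero (by rw [List.length_append, List.length_cons]; omega)
    simp only [h0]
    exact isDiffOp_zero 2

theorem isDiffOp_curvEnd_last (es : List (Sec n F E)) (αs : List (OneForm n M)) :
    IsDiffOp (Fun n M) 1 (fun e => D.curvEnd (es ++ [e]) αs) := by
  by_cases h : es.length + 1 + 2 * αs.length = 2
  · obtain rfl : αs = [] := List.length_eq_zero_iff.1 (by omega)
    rw [List.length_nil] at h
    obtain ⟨a, rfl⟩ := List.length_eq_one_iff.1 (show es.length = 1 by omega)
    refine isDiffOp_of_app fun b => ?_
    simpa only [List.cons_append, List.nil_append, curvEnd_pair_app] using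
      D.isDiffOp_curvSec_right a b
  · have h0 : ∀ e, D.curvEnd (es ++ [e]) αs = 0 := fun e =>
      D.curvEnd_eq_zero (by rw [List.length_append, List.length_singleton]; omega)
    simp only [h0]
    exact isDiffOp_zero 1

theorem isDiffOp_curvEnd (es es' : List (Sec n F E)) (αs : List (OneForm n M)) :
    IsDiffOp (Fun n M) 2 (fun e => D.curvEnd (es ++ e :: es') αs) := by
  by_cases h : es.length + es'.length + 1 + 2 * αs.length = 2
  · obtain ⟨rfl, ⟨a, rfl, rfl⟩ | ⟨a, rfl, rfl⟩⟩ := eq_singleton_of_length_append_cons_eq_two h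
    · refine isDiffOp_of_app fun b => ?_
      simpa only [List.nil_append, curvEnd_pair_app] using D.isDiffOp_curvSec_left a b
    · exact (D.isDiffOp_curvEnd_last [a] []).succ
  · have h0 : ∀ e, D.curvEnd (es ++ e :: es') αs = 0 := fun e =>
      D.curvEnd_eq_zero (by rw [List.length_append, List.length_cons]; omega)
    simp only [h0]
    exact isDiffOp_zero 2

theorem isDiffCochain_curvEnd : IsDiffCochain C 2 2 D.curvEnd where
  degree _ _ h := D.curvEnd_eq_zero h
  linear := D.isLinearMap_curvEnd
  linear_form := D.isLinearMap_curvEnd_form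
  symm_form es _ _ h := D.curvEnd_perm es h
  swap := D.curvEnd_swap
  order_form := D.isDiffOp_curvEnd_form
  order_init := D.isDiffOp_curvEnd
  order_last _ := D.isDiffOp_curvEnd_last

theorem curvature_dB (g : Fun n M) : D.curvature (P.dB g) = 0 := by
  funext es fs
  rw [← curvEnd_map_extd_app, curvEnd_app_dB]
  rfl

end DorfmanConnection

end Curvature

end Dorfman

end

open Dorfman in
theorem mainTheorem4 {n : ℕ} {M : Type*} [TopologicalSpace M] [T2Space M]
    [ChartedSpace (EuclideanSpace ℝ (Fin n)) M] [IsManifold (𝓡 n) ∞ M]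
    {F : Type*} [NormedAddCommGroup F] [NormedSpace ℝ F] [FiniteDimensional ℝ F]
    {E : M → Type*} [TopologicalSpace (TotalSpace F E)] [∀ x, AddCommGroup (E x)]
    [∀ x, Module ℝ (E x)] [∀ x, TopologicalSpace (E x)] [FiberBundle F E] [VectorBundle ℝ F E]
    [ContMDiffVectorBundle ∞ F E (𝓡 n)]
    [∀ x, IsTopologicalAddGroup (E x)] [∀ x, ContinuousSMul ℝ (E x)]
    {FB : Type*} [NormedAddCommGroup FB] [NormedSpace ℝ FB] [FiniteDimensional ℝ FB]
    {B : M → Type*} [TopologicalSpace (TotalSpace FB B)] [∀ x, AddCommGroup (B x)]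
    [∀ x, Module ℝ (B x)] [∀ x, TopologicalSpace (B x)] [FiberBundle FB B] [VectorBundle ℝ FB B]
    [ContMDiffVectorBundle ∞ FB B (𝓡 n)]
    [∀ x, IsTopologicalAddGroup (B x)] [∀ x, ContinuousSMul ℝ (B x)]
    (C : CourantAlgebroid n F E) (P : Predual FB B C) (D : DorfmanConnection P) :
    IsLinearMap (Fun n M) D.curvature ∧
    (∃ R : List (Sec n F E) → List (OneForm n M) → EndSec n FB B,
      IsDiffCochain C 2 2 R ∧
      (∀ b es fs, (R es (fs.map extd)).app b = D.curvature b es fs) ∧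
      (∀ α b, (R [] [α]).app b = D.nabla (C.rhoStar α) b) ∧
      ∀ es αs g, (R es αs).app (P.dB g) = 0) ∧
    (∀ e₁ e₂ b, ((D.curvature b).iSec e₁).iSec e₂ =
      Cochain.ofSection (D.nabla e₁ (D.nabla e₂ b) - D.nabla e₂ (D.nabla e₁ b)
        - D.nabla (C.bracket e₁ e₂) b)) ∧
    (∀ f b, (D.curvature b).iFun f = Cochain.ofSection (D.nabla (C.dE f) b)) ∧
    ∀ g, D.curvature (P.dB g) = 0 :=
  ⟨D.isLinearMap_curvature,
    ⟨D.curvEnd, D.isDiffCochain_curvEnd, D.curvEnd_map_extd_app, D.curvEnd_singleton_app,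
      D.curvEnd_app_dB⟩,
    D.iSec_iSec_curvature, D.iFun_curvature, D.curvature_dB⟩
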